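/- Let $\Bbbk$ be an algebraically closed field of characteristic zero and let $$A=\Bbbk[z]\langle x,y\rangle\,/\,\bigl(xz=(z+1)x,\ yz=(z-1)y,\ xy=z^2,\ yx=(z-1)^2\bigr),$$ the generalized Weyl algebra $A(z^2)$, graded by $\mathbb Z$ with $\deg x=1$, $\deg y=-1$, $\deg z=0$. Let $\operatorname{gr}A$ be the category of graded right $A$-modules with homomorphisms of degree $0$, and write $M\langle n\rangle_i=M_{i-n}$ for shifts. For $n\in\mathbb Z$ and a rank one graded projective module $P$ let $\iota_nP\subseteq P$ be the common kernel of all morphisms from $P$ to $(A/xA)\langle n\rangle$ and to $(A/yA)\langle n+1\rangle$ (this is the kernel of a surjection of $P$ onto exactly one of these two modules); $\iota_n$ acts on morphisms by restriction. Let $\mathbb Z_{\mathrm{fin}}$ be the group of finite subsets of $\mathbb Z$ under symmetric difference $\oplus$. For $J\in\mathbb Z_{\mathrm{fin}}$ let $\iota_J=\prod_{j\in J}\iota_j$ (with $\iota_\emptyset=\mathrm{Id}$) and $h_J=\prod_{j\in J}(z+j)^2$. Left multiplication by $h_{I\cap J}^{-1}$ is an isomorphism $\Theta_{J,I}\colon\iota_J\iota_IA\to\iota_{I\oplus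 J}A$. Let $B$ be the $\mathbb Z_{\mathrm{fin}}$-graded ring $$B=\bigoplus_{J\in\mathbb Z_{\mathrm{fin}}}\operatorname{Hom}_{\operatorname{gr}A}(A,\iota_JA),\qquad a\cdot b=\Theta_{J,I}\circ\iota_J(a)\circ b\quad\text{for } a\in B_I,\ b\in B_J .$$ Let $z\in B_\emptyset$ be left multiplication by $z$, and for $n\in\mathbb Z$ let $b_n\in B_{\{n\}}$ be the homomorphism $A\to\iota_nA$, $a\mapsto (z+n)^2a$. Then $B$ has the presentation $$B\;\cong\;\frac{\Bbbk[z][b_n\mid n\in\mathbb Z]}{\bigl(b_n^2=(z+n)^2\mid n\in\mathbb Z\bigr)},\qquad \deg z=\emptyset,\ \deg b_n=\{n\},$$ as a $\mathbb Z_{\mathrm{fin}}$-graded $\Bbbk$-algebra, by an isomorphism that sends the elements $z$ and $b_n$ of $B$ to the generators with the same names. -/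

import Mathlib

open CategoryTheory Polynomial

noncomputable section

namespace GenWeyl

universe u

/-! ### The generalized Weyl algebra `A(f)` and its `ℤ`-grading -/

/-- The names of the generators of `A(f)`. -/
inductive Gen
  | x
  | y
  | z

/-- The degrees of the generators. -/
def Gen.deg : Gen → ℤ
  | .x => 1
  | .y => -1
  | .z => 0

section Algebra

variable {k : Type u} [Field k]

open FreeAlgebra in
/-- The defining relations of `A(f)`, with `σ(z) = z + 1`. -/
inductive Rel (f : k[X]) : FreeAlgebra k Gen → FreeAlgebra k Gen → Prop
  | xz : Rel f (ι k .x * ι k .z) ((ι k .z + 1) * ι k .x)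
  | yz : Rel f (ι k .y * ι k .z) ((ι k .z - 1) * ι k .y)
  | xy : Rel f (ι k .x * ι k .y) (aeval (ι k .z) f)
  | yx : Rel f (ι k .y * ι k .x) (aeval (ι k .z) (f.comp (X - 1)))

/-- The generalized Weyl algebra
`A(f) = k[z]⟨x, y⟩ / (xz = σ(z)x, yz = σ⁻¹(z)y, xy = f, yx = σ⁻¹(f))`. -/
abbrev GWA (f : k[X]) : Type u := RingQuot (Rel f)

/-- The generators `x`, `y`, `z` of `A(f)`. -/
def gen (f : k[X]) (g : Gen) : GWA f := RingQuot.mkAlgHom k (Rel f) (FreeAlgebra.ι k g)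

/-- The degree `i` part of `A(f)`: the span of the words of degree `i` in `x`, `y`, `z`. -/
def grade (f : k[X]) (i : ℤ) : Submodule k (GWA f) :=
  Submodule.span k {a | ∃ w : List Gen, (w.map Gen.deg).sum = i ∧ a = (w.map (gen f)).prod}

variable (f : k[X])

theorem gen_xz : gen f .x * gen f .z = (gen f .z + 1) * gen f .x := by
  have := RingQuot.mkAlgHom_rel k (Rel.xz (f := f))
  simpa [gen] using this

theorem gen_yz : gen f .y * gen f .z = (gen f .z - 1) * gen f .y := by
  have := RingQuot.mkAlgHom_rel k (Rel.yz (f := f))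
  simpa [gen] using this

theorem gen_xy : gen f .x * gen f .y = aeval (gen f .z) f := by
  have := RingQuot.mkAlgHom_rel k (Rel.xy (f := f))
  rwa [map_mul, ← Polynomial.aeval_algHom_apply] at this

theorem gen_yx : gen f .y * gen f .x = aeval (gen f .z) (f.comp (X - 1)) := by
  have := RingQuot.mkAlgHom_rel k (Rel.yx (f := f))
  rwa [map_mul, ← Polynomial.aeval_algHom_apply] at this

/-- The universal property of `A(f)`. -/
theorem exists_lift {f : k[X]} {R : Type*} [Ring R] [Algebra k R] (v : Gen → R)
    (hxz : v .x * v .z = (v .z + 1) * v .x) (hyz : v .y * v .z = (v .z - 1) * v .y)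
    (hxy : v .x * v .y = aeval (v .z) f) (hyx : v .y * v .x = aeval (v .z) (f.comp (X - 1))) :
    ∃ F : GWA f →ₐ[k] R, ∀ g, F (gen f g) = v g := by
  refine ⟨RingQuot.liftAlgHom k ⟨FreeAlgebra.lift k v, ?_⟩, fun g => ?_⟩
  · intro a b h
    cases h
    · simpa using hxz
    · simpa using hyz
    · rw [map_mul, ← Polynomial.aeval_algHom_apply]; simpa using hxy
    · rw [map_mul, ← Polynomial.aeval_algHom_apply]; simpa using hyx
  · simp [gen]

theorem gwa_closure : Algebra.adjoin k (Set.range (gen f)) = ⊤ := by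
  have h := congrArg (Subalgebra.map (RingQuot.mkAlgHom k (Rel f)))
    (FreeAlgebra.adjoin_range_ι (R := k) (X := Gen))
  rw [AlgHom.map_adjoin, ← Set.range_comp, Algebra.map_top,
    (AlgHom.range_eq_top _).2 (RingQuot.mkAlgHom_surjective k (Rel f))] at h
  exact h

theorem gwa_induction {f : k[X]} {p : GWA f → Prop} (hg : ∀ g, p (gen f g))
    (hk : ∀ c : k, p (algebraMap k _ c)) (hadd : ∀ a b, p a → p b → p (a + b))
    (hmul : ∀ a b, p a → p b → p (a * b)) (a : GWA f) : p a := by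
  have ha : a ∈ Algebra.adjoin k (Set.range (gen f)) := by rw [gwa_closure]; trivial
  induction ha using Algebra.adjoin_induction with
  | mem a h => obtain ⟨g, rfl⟩ := h; exact hg g
  | algebraMap c => exact hk c
  | add a b _ _ h1 h2 => exact hadd a b h1 h2
  | mul a b _ _ h1 h2 => exact hmul a b h1 h2

theorem gen_mem (g : Gen) : gen f g ∈ grade f g.deg :=
  Submodule.subset_span ⟨[g], by simp⟩

theorem one_mem_grade : (1 : GWA f) ∈ grade f 0 :=
  Submodule.subset_span ⟨[], by simp⟩

theorem mul_mem_grade {f : k[X]} {i j : ℤ} {a b : GWA f} (ha : a ∈ grade f i)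
    (hb : b ∈ grade f j) : a * b ∈ grade f (i + j) := by
  induction ha using Submodule.span_induction with
  | zero => simp
  | add a a' _ _ h1 h2 => rw [add_mul]; exact add_mem h1 h2
  | smul c a _ h => rw [smul_mul_assoc]; exact Submodule.smul_mem _ _ h
  | mem a h =>
    obtain ⟨w, rfl, rfl⟩ := h
    induction hb using Submodule.span_induction with
    | zero => simp
    | add a a' _ _ h1 h2 => rw [mul_add]; exact add_mem h1 h2
    | smul c a _ h => rw [mul_smul_comm]; exact Submodule.smul_mem _ _ h
    | mem b h =>
      obtain ⟨w', rfl, rfl⟩ := h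
      exact Submodule.subset_span ⟨w ++ w', by simp⟩

/-- A criterion for a family of subspaces to be a direct sum decomposition. -/
theorem isInternal_of_proj {M : Type*} [AddCommGroup M] [Module k M] (g : ℤ → Submodule k M)
    (pr : ℤ → M →ₗ[k] M) (h1 : ∀ i, ∀ m ∈ g i, pr i m = m)
    (h2 : ∀ i j, i ≠ j → ∀ m ∈ g j, pr i m = 0) (h3 : iSup g = ⊤) : DirectSum.IsInternal g := by
  rw [DirectSum.isInternal_submodule_iff_iSupIndep_and_iSup_eq_top]
  refine ⟨fun i => ?_, h3⟩
  rw [Submodule.disjoint_def]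
  intro m hm hm'
  have : (⨆ j, ⨆ (_ : j ≠ i), g j) ≤ LinearMap.ker (pr i) :=
    iSup₂_le fun j hj m hm => h2 i j hj.symm m hm
  rw [← h1 i m hm]
  exact this hm'

theorem grade_iSup : iSup (grade f) = ⊤ := by
  rw [eq_top_iff]
  have key : ∀ w : List Gen, (w.map (gen f)).prod ∈ iSup (grade f) := fun w =>
    Submodule.mem_iSup_of_mem _ (Submodule.subset_span ⟨w, rfl, rfl⟩)
  rintro a -
  have ha : a ∈ Submodule.span k (Submonoid.closure (Set.range (gen f)) : Set (GWA f)) := by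
    rw [← Algebra.adjoin_eq_span, gwa_closure]; trivial
  refine (Submodule.span_le.2 ?_) ha
  intro b hb
  obtain ⟨l, hl, rfl⟩ := Submonoid.exists_list_of_mem_closure hb
  have : Nonempty Gen := ⟨.x⟩
  choose! v hv using hl
  have : l = (l.map v).map (gen f) := by
    rw [List.map_map]
    conv_lhs => rw [← List.map_id l]
    exact List.map_congr_left fun a ha => (hv a ha).symm
  rw [this]; exact key _

theorem aeval_single (z : GWA f) (p : k[X]) :
    aeval (AddMonoidAlgebra.single (0 : ℤ) z : AddMonoidAlgebra (GWA f) ℤ) p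
      = AddMonoidAlgebra.single 0 (aeval z p) :=
  Polynomial.aeval_algHom_apply
    (AddMonoidAlgebra.singleZeroAlgHom (R := k) (A := GWA f) (M := ℤ)) z p

theorem exists_coaction : ∃ F : GWA f →ₐ[k] AddMonoidAlgebra (GWA f) ℤ,
    ∀ g, F (gen f g) = AddMonoidAlgebra.single g.deg (gen f g) := by
  refine exists_lift (fun g => AddMonoidAlgebra.single g.deg (gen f g)) ?_ ?_ ?_ ?_
  all_goals simp only [Gen.deg, aeval_single, AddMonoidAlgebra.single_mul_single, gen_xz, gen_yz,
    gen_xy, gen_yx, AddMonoidAlgebra.one_def, ← AddMonoidAlgebra.single_add,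
    ← AddMonoidAlgebra.single_sub]
  all_goals norm_num [-LaurentPolynomial.single_eq_C_mul_T]

theorem exists_gradeProj : ∃ pr : ℤ → GWA f →ₗ[k] GWA f, (∀ i, ∀ m ∈ grade f i, pr i m = m) ∧
    ∀ i j, i ≠ j → ∀ m ∈ grade f j, pr i m = 0 := by
  obtain ⟨F, hF⟩ := exists_coaction f
  have hw : ∀ w : List Gen, F (w.map (gen f)).prod
      = AddMonoidAlgebra.single (w.map Gen.deg).sum (w.map (gen f)).prod := by
    intro w
    induction w with
    | nil => rw [List.map_nil, List.prod_nil, map_one, List.map_nil, List.sum_nil,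
        AddMonoidAlgebra.one_def]
    | cons g w ih => rw [List.map_cons, List.prod_cons, map_mul, ih, hF,
        AddMonoidAlgebra.single_mul_single, List.map_cons, List.sum_cons]
  have hs : ∀ i, ∀ a ∈ grade f i, F a = AddMonoidAlgebra.single i a := by
    intro i a ha
    induction ha using Submodule.span_induction with
    | mem a h => obtain ⟨w, rfl, rfl⟩ := h; exact hw w
    | zero => rw [map_zero, AddMonoidAlgebra.single_zero]
    | add a b _ _ h1 h2 => rw [map_add, h1, h2, AddMonoidAlgebra.single_add]
    | smul c a _ h => rw [map_smul, h, AddMonoidAlgebra.smul_single]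
  refine ⟨fun i => (Finsupp.lapply i).comp
    ((AddMonoidAlgebra.coeffLinearEquiv k).toLinearMap.comp F.toLinearMap), ?_, ?_⟩
  · intro i m hm
    change (F m).coeff i = m
    rw [hs i m hm, AddMonoidAlgebra.coeff_single, Finsupp.single_eq_same]
  · intro i j hij m hm
    change (F m).coeff i = 0
    rw [hs j m hm, AddMonoidAlgebra.coeff_single, Finsupp.single_eq_of_ne hij]

theorem grade_isInternal : DirectSum.IsInternal (grade f) := by
  obtain ⟨pr, h1, h2⟩ := exists_gradeProj f
  exact isInternal_of_proj _ pr h1 h2 (grade_iSup f)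

end Algebra

/-! ### Graded right modules over `A(f)` -/

section Modules

variable {k : Type u} [Field k]

/-- A `ℤ`-graded right `A(f)`-module: a right module (that is, a module over the opposite ring)
with a `k`-vector space decomposition `M = ⨁ M_i` such that `M_j · A_i ⊆ M_{j+i}`. -/
structure GrMod (f : k[X]) where
  /-- The underlying type. -/
  carrier : Type u
  [addCommGroup : AddCommGroup carrier]
  [moduleBase : Module k carrier]
  [module : Module (GWA f)ᵐᵒᵖ carrier]
  [isScalarTower : IsScalarTower k (GWA f)ᵐᵒᵖ carrier]
  /-- The graded pieces. -/
  deg : ℤ → Submodule k carrier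
  isInternal : DirectSum.IsInternal deg
  smul_mem : ∀ {i j : ℤ} {a : GWA f} {m : carrier},
    a ∈ grade f i → m ∈ deg j → MulOpposite.op a • m ∈ deg (j + i)

attribute [instance] GrMod.addCommGroup GrMod.moduleBase GrMod.module GrMod.isScalarTower

variable {f : k[X]}

instance : CoeSort (GrMod f) (Type u) := ⟨GrMod.carrier⟩

/-- The `k`-space `Hom_{gr A}(M, N)` of graded homomorphisms (of degree `0`): the right
`A`-module homomorphisms `φ` with `φ(M_i) ⊆ N_i` for all `i`. -/
def gradedHom (M N : GrMod f) : Submodule k (M →ₗ[(GWA f)ᵐᵒᵖ] N) where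
  carrier := {φ | ∀ i, ∀ m ∈ M.deg i, φ m ∈ N.deg i}
  add_mem' h1 h2 i m hm := add_mem (h1 i m hm) (h2 i m hm)
  zero_mem' _ _ _ := zero_mem _
  smul_mem' c _ h i m hm := Submodule.smul_mem _ c (h i m hm)

/-- The category of graded right `A(f)`-modules. -/
instance : Category (GrMod f) where
  Hom M N := gradedHom M N
  id M := ⟨LinearMap.id, fun _ _ h => h⟩
  comp φ ψ := ⟨ψ.1.comp φ.1, fun i m h => ψ.2 i _ (φ.2 i m h)⟩

theorem GrMod.id_val (M : GrMod f) : (𝟙 M : M ⟶ M).1 = LinearMap.id := rfl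

theorem GrMod.comp_val {M N P : GrMod f} (φ : M ⟶ N) (ψ : N ⟶ P) :
    (φ ≫ ψ).1 = ψ.1.comp φ.1 := rfl

namespace GrMod

/-- The decomposition of a graded module as the direct sum of its graded pieces. -/
def decomp (M : GrMod f) : (DirectSum ℤ fun i => M.deg i) ≃ₗ[k] M :=
  LinearEquiv.ofBijective (DirectSum.coeLinearMap M.deg)
    (show Function.Bijective (DirectSum.coeLinearMap M.deg) from M.isInternal)

theorem decomp_apply (M : GrMod f) (d : DirectSum ℤ fun i => M.deg i) :
    M.decomp d = DirectSum.coeLinearMap M.deg d := rfl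

/-- The projection of a graded module to its degree `i` part. -/
def proj (M : GrMod f) (i : ℤ) : M →ₗ[k] M :=
  (M.deg i).subtype.comp ((DirectSum.component k ℤ (fun j => M.deg j) i).comp
    M.decomp.symm.toLinearMap)

theorem proj_apply (M : GrMod f) (i : ℤ) (m : M) : M.proj i m = (M.decomp.symm m) i := rfl

theorem proj_mem (M : GrMod f) (i : ℤ) (m : M) : M.proj i m ∈ M.deg i := Subtype.prop _

theorem decomp_symm (M : GrMod f) {i : ℤ} {m : M} (hm : m ∈ M.deg i) :
    M.decomp.symm m = DirectSum.lof k ℤ (fun j => M.deg j) i ⟨m, hm⟩ := by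
  rw [LinearEquiv.symm_apply_eq, decomp_apply, DirectSum.coeLinearMap_lof]

theorem proj_same (M : GrMod f) {i : ℤ} {m : M} (hm : m ∈ M.deg i) : M.proj i m = m := by
  rw [proj_apply, decomp_symm M hm, DirectSum.lof_eq_of, DirectSum.of_eq_same]

theorem proj_ne (M : GrMod f) {i j : ℤ} (hij : i ≠ j) {m : M} (hm : m ∈ M.deg j) :
    M.proj i m = 0 := by
  rw [proj_apply, decomp_symm M hm, DirectSum.lof_eq_of, DirectSum.of_eq_of_ne _ _ _ hij]
  rfl

theorem iSup_deg (M : GrMod f) : iSup M.deg = ⊤ := M.isInternal.submodule_iSup_eq_top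

theorem induction (M : GrMod f) {p : M → Prop} (hz : p 0) (h : ∀ i, ∀ m ∈ M.deg i, p m)
    (hadd : ∀ a b, p a → p b → p (a + b)) (m : M) : p m := by
  have hm : m ∈ iSup M.deg := by rw [M.iSup_deg]; trivial
  exact Submodule.iSup_induction M.deg (motive := p) hm h hz hadd

theorem mem_of_proj (M : GrMod f) (N : Submodule k M) (m : M) (h : ∀ i, M.proj i m ∈ N) :
    m ∈ N := by
  classical
  obtain ⟨d, rfl⟩ := M.decomp.surjective m
  have h2 : ∀ i, ((d i : M.deg i) : M) ∈ N := fun i => by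
    have := h i
    rwa [proj_apply, LinearEquiv.symm_apply_apply] at this
  rw [decomp_apply, DirectSum.coeLinearMap_eq_dfinsuppSum]
  exact Submodule.dfinsuppSum_mem _ _ _ fun i _ => h2 i

theorem proj_map {M N : GrMod f} (φ : M ⟶ N) (i : ℤ) (m : M) :
    N.proj i (φ.1 m) = φ.1 (M.proj i m) := by
  induction m using M.induction with
  | hz => simp
  | hadd a b h1 h2 => simp only [map_add, h1, h2]
  | h j m hm =>
    by_cases hij : i = j
    · subst hij; rw [N.proj_same (φ.2 i m hm), M.proj_same hm]
    · rw [N.proj_ne hij (φ.2 j m hm), M.proj_ne hij hm, map_zero]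

/-- A submodule is graded if it contains the homogeneous components of its elements. -/
def IsGraded (M : GrMod f) (N : Submodule (GWA f)ᵐᵒᵖ M) : Prop :=
  ∀ i, ∀ m ∈ N, M.proj i m ∈ N

/-- A graded submodule, as a graded module. -/
def sub (M : GrMod f) (N : Submodule (GWA f)ᵐᵒᵖ M) (hN : M.IsGraded N) : GrMod f where
  carrier := N
  deg i := (M.deg i).comap (N.subtype.restrictScalars k)
  isInternal := by
    refine isInternal_of_proj _
      (fun i => ((M.proj i).restrict (p := N.restrictScalars k) (q := N.restrictScalars k)
        fun m hm => hN i m hm)) ?_ ?_ ?_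
    · intro i m hm; exact Subtype.ext (M.proj_same hm)
    · intro i j hij m hm; exact Subtype.ext (M.proj_ne hij hm)
    · rw [eq_top_iff]
      rintro ⟨m, hm⟩ -
      have key : m ∈ (⨆ i, (M.deg i).comap (N.subtype.restrictScalars k)).map
          (N.subtype.restrictScalars k) := by
        refine M.mem_of_proj _ m fun i => ?_
        exact ⟨⟨M.proj i m, hN i m hm⟩, Submodule.mem_iSup_of_mem i (M.proj_mem i m), rfl⟩
      obtain ⟨m', h1, h2⟩ := key
      have h3 : m' = ⟨m, hm⟩ := Subtype.ext h2
      exact h3 ▸ h1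
  smul_mem ha hm := M.smul_mem ha hm

/-- The quotient of a graded module by a graded submodule. -/
def quot (M : GrMod f) (N : Submodule (GWA f)ᵐᵒᵖ M) (hN : M.IsGraded N) : GrMod f where
  carrier := M ⧸ N
  deg i := (M.deg i).map (N.mkQ.restrictScalars k)
  isInternal := by
    refine isInternal_of_proj _
      (fun i => Submodule.mapQ (N.restrictScalars k) (N.restrictScalars k) (M.proj i)
        fun m hm => hN i m hm) ?_ ?_ ?_
    · rintro i _ ⟨m, hm, rfl⟩
      exact congrArg N.mkQ (M.proj_same hm)
    · rintro i j hij _ ⟨m, hm, rfl⟩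
      exact (congrArg N.mkQ (M.proj_ne hij hm)).trans (map_zero _)
    · rw [← Submodule.map_iSup, M.iSup_deg, Submodule.map_top, LinearMap.range_eq_top]
      exact N.mkQ_surjective
  smul_mem := by
    rintro i j a _ ha ⟨m, hm, rfl⟩
    exact ⟨_, M.smul_mem ha hm, map_smul N.mkQ _ _⟩

/-- The shifted module `M⟨n⟩`, with `M⟨n⟩_i = M_{i-n}`. -/
def shift (M : GrMod f) (n : ℤ) : GrMod f where
  carrier := M
  deg i := M.deg (i - n)
  isInternal := by
    refine isInternal_of_proj _ (fun i => M.proj (i - n)) ?_ ?_ ?_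
    · intro i m hm; exact M.proj_same hm
    · intro i j hij m hm; exact M.proj_ne (by simpa using hij) hm
    · rw [← M.iSup_deg]
      exact (Equiv.subRight n).iSup_comp (g := M.deg)
  smul_mem {i j a m} ha hm := by
    rw [show j + i - n = j - n + i by ring]; exact M.smul_mem ha hm

variable (f) in
/-- The right module `A`. -/
def regular : GrMod f where
  carrier := GWA f
  deg := grade f
  isInternal := grade_isInternal f
  smul_mem ha hm := mul_mem_grade hm ha

/-- The projection of `A` to its degree `i` part. -/
def regProj (i : ℤ) : GWA f →ₗ[k] GWA f := (regular f).proj i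

theorem regProj_same {i : ℤ} {a : GWA f} (ha : a ∈ grade f i) : regProj i a = a :=
  (regular f).proj_same ha

theorem regProj_ne {i j : ℤ} (hij : i ≠ j) {a : GWA f} (ha : a ∈ grade f j) : regProj i a = 0 :=
  (regular f).proj_ne hij ha

theorem regProj_mem (i : ℤ) (a : GWA f) : regProj i a ∈ grade f i := (regular f).proj_mem i a

theorem regProj_mul {d : ℤ} {g : GWA f} (hg : g ∈ grade f d) (i : ℤ) (a : GWA f) :
    regProj i (g * a) = g * regProj (i - d) a := by
  refine (regular f).induction (p := fun a : GWA f => regProj i (g * a)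
    = g * regProj (i - d) a) ?_ ?_ ?_ a
  · change regProj i (g * (0 : GWA f)) = g * regProj (i - d) (0 : GWA f)
    rw [mul_zero, map_zero, map_zero, mul_zero]
  · intro j (m : GWA f) hm
    by_cases hij : i = d + j
    · subst hij
      rw [regProj_same (mul_mem_grade hg hm), add_sub_cancel_left, regProj_same hm]
    · rw [regProj_ne hij (mul_mem_grade hg hm), regProj_ne _ hm, mul_zero]
      intro h; apply hij; rw [← h]; ring
  · intro (a : GWA f) (b : GWA f) h1 h2
    change regProj i (g * (a + b)) = g * regProj (i - d) (a + b)
    rw [mul_add, map_add, map_add, h1, h2, mul_add]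

/-- A principal right ideal generated by one of the generators is graded. -/
theorem isGraded_span_gen (g : Gen) :
    (regular f).IsGraded (Submodule.span (GWA f)ᵐᵒᵖ {(gen f g : GWA f)}) := by
  intro i m hm
  obtain ⟨a, rfl⟩ := Submodule.mem_span_singleton.1 hm
  change regProj i (gen f g * a.unop) ∈ Submodule.span (GWA f)ᵐᵒᵖ {(gen f g : GWA f)}
  rw [regProj_mul (gen_mem f g)]
  exact Submodule.mem_span_singleton.2 ⟨MulOpposite.op _, rfl⟩

variable (f) in
/-- The cyclic right module `A/gA`, for a generator `g` of `A`. -/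
def cyclic (g : Gen) : GrMod f :=
  (regular f).quot (Submodule.span (GWA f)ᵐᵒᵖ {(gen f g : GWA f)}) (isGraded_span_gen g)

/-- The intersection of the kernels of all graded homomorphisms from `M` to `N`. -/
def reject (M N : GrMod f) : Submodule (GWA f)ᵐᵒᵖ M :=
  ⨅ φ : M ⟶ N, LinearMap.ker φ.1

theorem mem_reject {M N : GrMod f} {m : M} : m ∈ M.reject N ↔ ∀ φ : M ⟶ N, φ.1 m = 0 := by
  simp only [reject, Submodule.mem_iInf, LinearMap.mem_ker]

theorem isGraded_reject (M N : GrMod f) : M.IsGraded (M.reject N) := by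
  intro i m hm
  rw [mem_reject] at hm ⊢
  intro φ
  rw [← proj_map, hm, map_zero]

theorem map_reject {M M' : GrMod f} (N : GrMod f) (φ : M ⟶ M') {m : M} (hm : m ∈ M.reject N) :
    φ.1 m ∈ M'.reject N := by
  rw [mem_reject] at hm ⊢
  intro ψ
  exact hm (φ ≫ ψ)

end GrMod

end Modules

/-! ### The involutions -/

section Involutions

variable {k : Type u} [Field k]

variable (k) in
/-- The generalized Weyl algebra `A = A(z²)`. -/
abbrev A : Type u := GWA (X ^ 2 : k[X])

variable (k) in
/-- Graded right modules over `A = A(z²)`. -/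
abbrev GrA := GrMod (X ^ 2 : k[X])

variable (k) in
/-- `A` as a graded right module over itself. -/
abbrev regA : GrA k := GrMod.regular (X ^ 2 : k[X])

variable (k) in
/-- The indecomposable module `(A/xA)⟨n⟩`, a self-extension of the simple module `X⟨n⟩`. -/
def indecX (n : ℤ) : GrA k := (GrMod.cyclic _ .x).shift n

variable (k) in
/-- The indecomposable module `(A/yA)⟨n+1⟩`, a self-extension of the simple module `Y⟨n⟩`. -/
def indecY (n : ℤ) : GrA k := (GrMod.cyclic _ .y).shift (n + 1)

/-- The submodule `ι_n M` of `M`. A rank one projective `P` surjects onto exactly one of `X⟨n⟩`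
and `Y⟨n⟩`, has nonzero graded homomorphisms to exactly one of the indecomposable modules
`(A/xA)⟨n⟩` and `(A/yA)⟨n+1⟩`, and surjects onto that one with kernel `ι_n P`; that kernel is
the common kernel of all graded homomorphisms from `P` to the two modules. -/
def invSub (n : ℤ) (M : GrA k) : Submodule (A k)ᵐᵒᵖ M :=
  M.reject (indecX k n) ⊓ M.reject (indecY k n)

theorem isGraded_invSub (n : ℤ) (M : GrA k) : M.IsGraded (invSub n M) := fun i m hm =>
  ⟨M.isGraded_reject _ i m hm.1, M.isGraded_reject _ i m hm.2⟩

theorem map_invSub (n : ℤ) {M N : GrA k} (φ : M ⟶ N) {m : M} (hm : m ∈ invSub n M) :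
    φ.1 m ∈ invSub n N :=
  ⟨GrMod.map_reject _ φ hm.1, GrMod.map_reject _ φ hm.2⟩

variable (k) in
/-- The involution `ι_n`, a subfunctor of the identity: it acts on morphisms by restriction. -/
def inv (n : ℤ) : GrA k ⥤ GrA k where
  obj M := M.sub (invSub n M) (isGraded_invSub n M)
  map {M N} φ := ⟨φ.1.restrict fun _ hm => map_invSub n φ hm, fun i m hm => φ.2 i _ hm⟩

/-- The inclusion of `ι_n` into the identity functor. -/
def invIncl (n : ℤ) : inv k n ⟶ 𝟭 (GrA k) where
  app M := ⟨(invSub n M).subtype, fun _ _ h => h⟩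

/-- The composite `ι_{n₁} ι_{n₂} ⋯` over a list `[n₁, n₂, …]`. -/
def invList : List ℤ → (GrA k ⥤ GrA k)
  | [] => 𝟭 _
  | n :: L => invList L ⋙ inv k n

/-- The inclusion of `ι_{n₁} ι_{n₂} ⋯` into the identity functor. -/
def invListIncl : (L : List ℤ) → (invList L ⟶ 𝟭 (GrA k))
  | [] => 𝟙 _
  | n :: L =>
    { app := fun M => (invIncl n).app ((invList L).obj M) ≫ (invListIncl L).app M
      naturality := fun M N φ => by
        have h1 := (invIncl n).naturality ((invList L).map φ)
        have h2 := (invListIncl L).naturality φ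
        simp only [Functor.id_map] at h1 h2
        simp only [invList, Functor.comp_map, Functor.id_map]
        rw [← Category.assoc, h1, Category.assoc, h2, Category.assoc] }

/-- The group `ℤ_fin` of finite subsets of `ℤ` with operation exclusive or, written additively. -/
abbrev ZFin : Type := AsBoolRing (Finset ℤ)

instance : DecidableEq ZFin := inferInstanceAs (DecidableEq (Finset ℤ))

/-- The elements of `J ∈ ℤ_fin`. -/
def ZFin.toFinset (J : ZFin) : Finset ℤ := ofBoolRing J

/-- The element `{n}` of `ℤ_fin`. -/
def ZFin.single (n : ℤ) : ZFin := toBoolRing {n}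

theorem ZFin.toFinset_add (I J : ZFin) : (I + J).toFinset = symmDiff I.toFinset J.toFinset := rfl

variable (k) in
/-- The composite `ι_J` of the involutions `ι_j` for `j ∈ J`, with `ι_∅ = Id`. -/
def invSet (J : ZFin) : GrA k ⥤ GrA k := invList (J.toFinset.sort (· ≤ ·))

/-- The inclusion of `ι_J` into the identity functor. -/
def invSetIncl (J : ZFin) : invSet k J ⟶ 𝟭 (GrA k) := invListIncl _

variable (k) in
/-- The polynomial `h_J = ∏_{j ∈ J} (z + j)²`. -/
def hPoly (J : Finset ℤ) : k[X] := ∏ j ∈ J, (X + C (j : k)) ^ 2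

end Involutions

/-! ### Auxiliary facts: the modules `ι_J A` in coordinates -/

section Ladder

variable {k : Type u} [Field k]

/-- A polynomial in `z`, as an element of `A`. -/
def pz (p : k[X]) : A k := aeval (gen _ .z) p

theorem pz_mul (p q : k[X]) : pz (p * q) = pz p * pz q := map_mul _ _ _

theorem pz_comm (p q : k[X]) : pz p * pz q = pz q * pz p := by
  rw [← pz_mul, ← pz_mul, mul_comm]

theorem pz_add (p q : k[X]) : pz (p + q) = pz p + pz q := map_add _ _ _

theorem pz_one : pz (1 : k[X]) = 1 := map_one _

theorem pz_mul_x (p : k[X]) : pz p * gen _ .x = gen _ .x * pz (p.comp (X - 1)) := by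
  have h := gen_xz (X ^ 2 : k[X])
  have hz : gen (X ^ 2 : k[X]) .z * gen _ .x = gen _ .x * pz (X - 1 : k[X]) := by
    simp only [pz, map_sub, aeval_X, map_one, mul_sub, h, add_mul, mul_one, one_mul,
      add_sub_cancel_right]
  induction p using Polynomial.induction_on' with
  | add p q hp hq => simp only [pz, map_add, add_comp, add_mul, mul_add] at *; rw [hp, hq]
  | monomial n a =>
    rw [← C_mul_X_pow_eq_monomial]
    induction n with
    | zero => simp [pz, Algebra.commutes]
    | succ n ih =>
      rw [pow_succ (X : k[X]) n, ← mul_assoc, mul_comp (C a * X ^ n) X, X_comp,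
        pz_mul (C a * X ^ n) X, mul_assoc, show pz (X : k[X]) = gen _ .z from aeval_X _,
        hz, ← mul_assoc, ih, mul_assoc, ← pz_mul]

theorem pz_mul_y (p : k[X]) : pz p * gen _ .y = gen _ .y * pz (p.comp (X + 1)) := by
  have h := gen_yz (X ^ 2 : k[X])
  have hz : gen (X ^ 2 : k[X]) .z * gen _ .y = gen _ .y * pz (X + 1 : k[X]) := by
    simp only [pz, map_add, aeval_X, map_one, mul_add, h, sub_mul, mul_one, one_mul,
      sub_add_cancel]
  induction p using Polynomial.induction_on' with
  | add p q hp hq => simp only [pz, map_add, add_comp, add_mul, mul_add] at *; rw [hp, hq]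
  | monomial n a =>
    rw [← C_mul_X_pow_eq_monomial]
    induction n with
    | zero => simp [pz, Algebra.commutes]
    | succ n ih =>
      rw [pow_succ (X : k[X]) n, ← mul_assoc, mul_comp (C a * X ^ n) X, X_comp,
        pz_mul (C a * X ^ n) X, mul_assoc, show pz (X : k[X]) = gen _ .z from aeval_X _,
        hz, ← mul_assoc, ih, mul_assoc, ← pz_mul]

theorem x_mul_y : gen (X ^ 2 : k[X]) .x * gen _ .y = pz (X ^ 2) := gen_xy _

theorem y_mul_x : gen (X ^ 2 : k[X]) .y * gen _ .x = pz ((X - 1) ^ 2) := by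
  rw [gen_yx]; simp [pz]

/-- The right action of `A` on a module. -/
def ra {M : GrA k} (m : M) (a : A k) : M := MulOpposite.op a • m

theorem ra_mul {M : GrA k} (m : M) (a b : A k) : ra m (a * b) = ra (ra m a) b := by
  simp [ra, mul_smul]

theorem ra_one {M : GrA k} (m : M) : ra m 1 = m := by simp [ra]

theorem ra_add {M : GrA k} (m : M) (a b : A k) : ra m (a + b) = ra m a + ra m b := by
  simp [ra, add_smul]

theorem add_ra {M : GrA k} (m m' : M) (a : A k) : ra (m + m') a = ra m a + ra m' a := by
  simp [ra]

theorem zero_ra {M : GrA k} (a : A k) : ra (0 : M) a = 0 := by simp [ra]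

theorem ra_smul {M : GrA k} (m : M) (c : k) (a : A k) : ra m (c • a) = c • ra m a := by
  simp [ra, MulOpposite.op_smul]

theorem map_ra {M N : GrA k} (φ : M ⟶ N) (m : M) (a : A k) : φ.1 (ra m a) = ra (φ.1 m) a :=
  map_smul φ.1 _ _

theorem ra_mem {M : GrA k} {i j l : ℤ} {m : M} {a : A k} (hm : m ∈ M.deg i)
    (ha : a ∈ grade _ j) (h : i + j = l) : ra m a ∈ M.deg l := h ▸ M.smul_mem ha hm

theorem pz_mem (p : k[X]) : pz p ∈ grade (X ^ 2 : k[X]) 0 := by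
  induction p using Polynomial.induction_on' with
  | add p q hp hq => rw [pz, map_add]; exact add_mem hp hq
  | monomial n a =>
    rw [← C_mul_X_pow_eq_monomial]
    induction n with
    | zero =>
      rw [pow_zero, mul_one, pz, aeval_C, Algebra.algebraMap_eq_smul_one]
      exact Submodule.smul_mem _ _ (one_mem_grade _)
    | succ n ih =>
      rw [pow_succ (X : k[X]) n, ← mul_assoc, pz_mul, show pz (X : k[X]) = gen _ .z from aeval_X _]
      have := mul_mem_grade ih (gen_mem (X ^ 2 : k[X]) .z)
      rwa [Gen.deg, add_zero] at this

theorem ra_pz_mem {M : GrA k} {i : ℤ} {m : M} (hm : m ∈ M.deg i) (p : k[X]) :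
    ra m (pz p) ∈ M.deg i := ra_mem hm (pz_mem p) (add_zero i)

theorem ra_x_mem {M : GrA k} {i : ℤ} {m : M} (hm : m ∈ M.deg i) :
    ra m (gen _ .x) ∈ M.deg (i + 1) := ra_mem hm (gen_mem _ .x) rfl

theorem ra_y_mem {M : GrA k} {i : ℤ} {m : M} (hm : m ∈ M.deg (i + 1)) :
    ra m (gen _ .y) ∈ M.deg i := ra_mem hm (gen_mem _ .y) (by simp [Gen.deg])

theorem ra_pz_x {M : GrA k} (m : M) (p : k[X]) :
    ra (ra m (pz p)) (gen _ .x) = ra (ra m (gen _ .x)) (pz (p.comp (X - 1))) := by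
  rw [← ra_mul, pz_mul_x, ra_mul]

theorem ra_pz_y {M : GrA k} (m : M) (p : k[X]) :
    ra (ra m (pz p)) (gen _ .y) = ra (ra m (gen _ .y)) (pz (p.comp (X + 1))) := by
  rw [← ra_mul, pz_mul_y, ra_mul]

theorem ra_xy {M : GrA k} (m : M) : ra (ra m (gen _ .x)) (gen _ .y) = ra m (pz (X ^ 2)) := by
  rw [← ra_mul, x_mul_y]

theorem ra_yx {M : GrA k} (m : M) :
    ra (ra m (gen _ .y)) (gen _ .x) = ra m (pz ((X - 1) ^ 2)) := by
  rw [← ra_mul, y_mul_x]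

theorem ra_pz_pz {M : GrA k} (m : M) (p q : k[X]) :
    ra (ra m (pz p)) (pz q) = ra m (pz (p * q)) := by rw [← ra_mul, pz_mul]

/-- Homogeneous free generators `w i` of the graded pieces of a graded module, linked by `x` at
the positions `i` with `s i` and by `y` at the others. -/
structure IsLadder (M : GrA k) (s : ℤ → Bool) (w : ℤ → M) : Prop where
  mem : ∀ i, w i ∈ M.deg i
  span : ∀ i, ∀ m ∈ M.deg i, ∃ p : k[X], m = ra (w i) (pz p)
  free : ∀ i (p : k[X]), ra (w i) (pz p) = 0 → p = 0
  up : ∀ i, s i = true → ra (w i) (gen _ .x) = w (i + 1)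
  down : ∀ i, s i = false → ra (w (i + 1)) (gen _ .y) = w i

/-- Homomorphisms out of a ladder are determined by the images of the generators. -/
theorem IsLadder.hom_ext {M N : GrA k} {s : ℤ → Bool} {w : ℤ → M} (h : IsLadder M s w)
    {φ ψ : M ⟶ N} (he : ∀ i, φ.1 (w i) = ψ.1 (w i)) : φ = ψ := by
  refine Subtype.ext (LinearMap.ext fun m => ?_)
  induction m using M.induction with
  | hz => simp
  | hadd a b h1 h2 => simp only [map_add, h1, h2]
  | h i m hm =>
    obtain ⟨p, rfl⟩ := h.span i m hm
    rw [map_ra, map_ra, he]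

/-- Homomorphisms out of a ladder exist. -/
theorem IsLadder.exists_hom {M N : GrA k} {s : ℤ → Bool} {w : ℤ → M} (h : IsLadder M s w)
    (t : ℤ → N) (ht : ∀ i, t i ∈ N.deg i)
    (up : ∀ i, s i = true → ra (t i) (gen _ .x) = t (i + 1))
    (down : ∀ i, s i = false → ra (t (i + 1)) (gen _ .y) = t i) :
    ∃ φ : M ⟶ N, ∀ i, φ.1 (w i) = t i := by
  have hlin : ∀ {P : GrA k} (u : P), ∃ F : k[X] →ₗ[k] P, ∀ p, F p = ra u (pz p) := by
    intro P u
    exact ⟨{ toFun := fun p => ra u (pz p)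
             map_add' := fun p q => by rw [← ra_add]; simp [pz]
             map_smul' := fun c p => by
              rw [RingHom.id_apply, ← ra_smul]; simp [pz] }, fun p => rfl⟩
  choose Fw hFw using fun i => hlin (w i)
  choose Ft hFt using fun i => hlin (t i)
  have hbij : ∀ i, Function.Bijective
      ((Fw i).codRestrict (M.deg i) fun p => by rw [hFw]; exact ra_pz_mem (h.mem i) p) := by
    intro i
    constructor
    · rw [← LinearMap.ker_eq_bot, LinearMap.ker_eq_bot']
      intro p hp
      apply h.free i p
      rw [← hFw]
      exact congrArg Subtype.val hp
    · rintro ⟨m, hm⟩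
      obtain ⟨p, rfl⟩ := h.span i m hm
      exact ⟨p, Subtype.ext (hFw i p)⟩
  let e := fun i => LinearEquiv.ofBijective _ (hbij i)
  let Φ : M →ₗ[k] N := (DirectSum.toModule k ℤ N
    fun i => (Ft i).comp (e i).symm.toLinearMap).comp M.decomp.symm.toLinearMap
  have hΦ : ∀ i p, Φ (ra (w i) (pz p)) = ra (t i) (pz p) := by
    intro i p
    have h1 := ra_pz_mem (h.mem i) p
    change DirectSum.toModule k ℤ N _ (M.decomp.symm _) = _
    rw [M.decomp_symm h1, DirectSum.toModule_lof, LinearMap.comp_apply, ← hFt]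
    congr 1
    rw [LinearEquiv.coe_coe, LinearEquiv.symm_apply_eq]
    exact Subtype.ext (hFw i p).symm
  have key : ∀ (a : A k) (m : M), Φ (ra m a) = ra (Φ m) a := by
    intro a
    induction a using gwa_induction with
    | hk c =>
      intro m
      rw [Algebra.algebraMap_eq_smul_one, ra_smul, ra_smul, ra_one, ra_one, map_smul]
    | hadd a b h1 h2 => intro m; rw [ra_add, map_add, h1, h2, ra_add]
    | hmul a b h1 h2 => intro m; rw [ra_mul, h2, h1, ra_mul]
    | hg g =>
      intro m
      induction m using M.induction with
      | hz => rw [zero_ra, map_zero, zero_ra]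
      | hadd a b h1 h2 => rw [add_ra, map_add, h1, h2, map_add, add_ra]
      | h i m hm =>
        obtain ⟨p, rfl⟩ := h.span i m hm
        rw [hΦ]
        cases g with
        | z =>
          rw [← show pz (X : k[X]) = gen _ .z from aeval_X _, ra_pz_pz, hΦ, ra_pz_pz]
        | x =>
          rw [ra_pz_x, ra_pz_x]
          cases hs : s i with
          | true => rw [h.up i hs, up i hs, hΦ]
          | false => rw [← h.down i hs, ← down i hs, ra_yx, ra_yx, ra_pz_pz, ra_pz_pz, hΦ]
        | y =>
          obtain ⟨i, rfl⟩ : ∃ j, i = j + 1 := ⟨i - 1, by ring⟩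
          rw [ra_pz_y, ra_pz_y]
          cases hs : s i with
          | false => rw [h.down i hs, down i hs, hΦ]
          | true => rw [← h.up i hs, ← up i hs, ra_xy, ra_xy, ra_pz_pz, ra_pz_pz, hΦ]
  refine ⟨⟨{ Φ with map_smul' := fun a m => key a.unop m }, ?_⟩, ?_⟩
  · intro i m hm
    obtain ⟨p, rfl⟩ := h.span i m hm
    change Φ _ ∈ _
    rw [hΦ]
    exact ra_pz_mem (ht i) p
  · intro i
    have := hΦ i 1
    rwa [pz_one, ra_one, ra_one] at this

/-! #### The ladder of `A` -/

/-- The generators `x^i` and `y^{-i}` of the graded pieces of `A`. -/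
def regW (i : ℤ) : A k := if 0 ≤ i then gen _ .x ^ i.toNat else gen _ .y ^ (-i).toNat

theorem regW_up {i : ℤ} (hi : 0 ≤ i) : regW i * gen (X ^ 2 : k[X]) .x = regW (i + 1) := by
  rw [regW, regW, if_pos hi, if_pos (by omega), ← pow_succ]
  congr 1; omega

theorem regW_down {i : ℤ} (hi : i < 0) : regW (i + 1) * gen (X ^ 2 : k[X]) .y = regW i := by
  rw [regW, regW, if_neg (not_le.2 hi)]
  split_ifs with h
  · obtain rfl : i = -1 := by omega
    simp
  · rw [← pow_succ]
    congr 1; omega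

theorem regW_zero : regW 0 = (1 : A k) := by simp [regW]

theorem regW_mem (i : ℤ) : regW i ∈ grade (X ^ 2 : k[X]) i := by
  have hp : ∀ (g : Gen) (m : ℕ), gen (X ^ 2 : k[X]) g ^ m ∈ grade (X ^ 2 : k[X]) (m * g.deg) := by
    intro g m
    induction m with
    | zero => simpa using one_mem_grade (X ^ 2 : k[X])
    | succ m ih =>
      rw [pow_succ (gen _ g) m, show ((m + 1 : ℕ) : ℤ) * g.deg = m * g.deg + g.deg by push_cast; ring]
      exact mul_mem_grade ih (gen_mem _ g)
  rw [regW]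
  split_ifs with h
  · have := hp .x i.toNat
    rwa [Gen.deg, mul_one, Int.toNat_of_nonneg h] at this
  · have := hp .y (-i).toNat
    rwa [Gen.deg, Int.toNat_of_nonneg (by omega), show -i * -1 = i by ring] at this

/-- The action of `A` on `k[z]`. -/
theorem exists_rep : ∃ F : A k →ₐ[k] Module.End k k[X], (∀ p v, F (pz p) v = p * v) ∧
    (∀ v, F (gen _ .x) v = 0 → v = 0) ∧ (∀ v, F (gen _ .y) v = 0 → v = 0) := by
  let σ : k[X] →ₐ[k] k[X] := aeval (X + 1)
  let τ : k[X] →ₐ[k] k[X] := aeval (X - 1)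
  have hσ : σ X = X + 1 := aeval_X _
  have hτ : τ X = X - 1 := aeval_X _
  have hστ : ∀ v, σ (τ v) = v := fun v => by
    have : σ.comp τ = AlgHom.id k k[X] := by
      apply Polynomial.algHom_ext; simp [hσ, hτ]
    exact DFunLike.congr_fun this v
  have hτσ : ∀ v, τ (σ v) = v := fun v => by
    have : τ.comp σ = AlgHom.id k k[X] := by
      apply Polynomial.algHom_ext; simp [hσ, hτ]
    exact DFunLike.congr_fun this v
  let Z : Module.End k k[X] := LinearMap.mulLeft k X
  have hp : ∀ p v, aeval Z p v = p * v := by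
    intro p v
    have := Polynomial.aeval_algHom_apply (Algebra.lmul k k[X]) (X : k[X]) p
    rw [aeval_X_left_apply] at this
    exact DFunLike.congr_fun this v
  let v : Gen → Module.End k k[X] := fun g => match g with
    | .x => σ.toLinearMap
    | .y => τ.toLinearMap.comp (LinearMap.mulLeft k (X ^ 2))
    | .z => Z
  obtain ⟨F, hF⟩ := exists_lift (f := (X ^ 2 : k[X])) v (by
      refine LinearMap.ext fun u => ?_
      change σ (X * u) = X * σ u + σ u
      rw [map_mul, hσ, add_mul, one_mul]) (by
      refine LinearMap.ext fun u => ?_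
      change τ (X ^ 2 * (X * u)) = X * τ (X ^ 2 * u) - τ (X ^ 2 * u)
      rw [map_mul, map_mul, map_mul, hτ]
      ring) (by
      refine LinearMap.ext fun u => ?_
      change σ (τ (X ^ 2 * u)) = aeval Z (X ^ 2) u
      rw [hστ, hp]) (by
      refine LinearMap.ext fun u => ?_
      change τ (X ^ 2 * σ u) = aeval Z ((X ^ 2 : k[X]).comp (X - 1)) u
      rw [hp, map_mul, hτσ, map_pow, hτ]
      simp)
  refine ⟨F, ?_, ?_, ?_⟩
  · intro p u
    rw [pz, ← Polynomial.aeval_algHom_apply, hF]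
    exact hp p u
  · intro u hu
    rw [hF] at hu
    change σ u = 0 at hu
    rw [← hτσ u, hu, map_zero]
  · intro u hu
    rw [hF] at hu
    change τ (X ^ 2 * u) = 0 at hu
    have h2 : X ^ 2 * u = 0 := by rw [← hστ (X ^ 2 * u), hu, map_zero]
    exact (mul_eq_zero.1 h2).resolve_left (pow_ne_zero _ X_ne_zero)

theorem regW_free (i : ℤ) (p : k[X]) (h : regW i * pz p = 0) : p = 0 := by
  obtain ⟨F, hz, hx, hy⟩ := exists_rep (k := k)
  have hpow : ∀ (a : A k), (∀ v, F a v = 0 → v = 0) → ∀ m : ℕ, ∀ v, F (a ^ m) v = 0 → v = 0 := by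
    intro a ha m
    induction m with
    | zero => intro v hv; simpa using hv
    | succ m ih => intro v hv; rw [pow_succ a m, map_mul] at hv; exact ha v (ih _ hv)
  have h1 : F (regW i) p = 0 := by
    have := DFunLike.congr_fun (congrArg F h) (1 : k[X])
    rw [map_mul, map_zero] at this
    change F (regW i) (F (pz p) 1) = 0 at this
    rwa [hz, mul_one] at this
  rw [regW] at h1
  split_ifs at h1
  · exact hpow _ hx _ _ h1
  · exact hpow _ hy _ _ h1

theorem regW_span (i : ℤ) (a : A k) (ha : a ∈ grade (X ^ 2 : k[X]) i) :
    ∃ p, a = regW i * pz p := by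
  induction ha using Submodule.span_induction with
  | zero => exact ⟨0, by simp [pz]⟩
  | add a b _ _ h1 h2 =>
    obtain ⟨p, rfl⟩ := h1
    obtain ⟨q, rfl⟩ := h2
    exact ⟨p + q, by simp [pz, mul_add]⟩
  | smul c a _ h1 =>
    obtain ⟨p, rfl⟩ := h1
    exact ⟨c • p, by simp [pz]⟩
  | mem a h =>
    obtain ⟨w, rfl, rfl⟩ := h
    induction w using List.reverseRecOn with
    | nil => exact ⟨1, by simp [regW_zero, pz]⟩
    | append_singleton w g ih =>
      obtain ⟨p, hp⟩ := ih
      rw [List.map_append, List.prod_append, hp, List.map_append, List.sum_append]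
      generalize (w.map Gen.deg).sum = i
      simp only [List.map_cons, List.map_nil, List.prod_singleton, List.sum_singleton]
      cases g with
      | z =>
        refine ⟨p * X, ?_⟩
        rw [Gen.deg, add_zero, pz_mul, show pz (X : k[X]) = gen _ .z from aeval_X _, mul_assoc]
      | x =>
        rw [mul_assoc, pz_mul_x, ← mul_assoc]
        by_cases hi : 0 ≤ i
        · exact ⟨_, by rw [regW_up hi]; rfl⟩
        · rw [← regW_down (not_le.1 hi), mul_assoc (regW (i + 1)), y_mul_x, mul_assoc, ← pz_mul]
          exact ⟨_, rfl⟩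
      | y =>
        obtain ⟨i, rfl⟩ : ∃ j, i = j + 1 := ⟨i - 1, by ring⟩
        rw [mul_assoc, pz_mul_y, ← mul_assoc, show i + 1 + Gen.y.deg = i by simp [Gen.deg]]
        by_cases hi : 0 ≤ i
        · rw [← regW_up hi, mul_assoc (regW i), x_mul_y, mul_assoc, ← pz_mul]
          exact ⟨_, rfl⟩
        · exact ⟨_, by rw [regW_down (not_le.1 hi)]⟩

theorem isLadder_reg : IsLadder (regA k) (fun i => decide (0 ≤ i)) (regW (k := k)) where
  mem i := regW_mem i
  span i m hm := regW_span i m hm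
  free i p h := regW_free i p h
  up i hi := regW_up (by simpa using hi)
  down i hi := regW_down (by simpa using hi)

/-- Left multiplication by a polynomial in `z` is injective on `A`. -/
theorem pz_mul_regW (p : k[X]) (i : ℤ) : pz p * regW i = regW i * pz (p.comp (X - C (i : k))) := by
  have hp : ∀ (g : Gen) (c : k), (∀ p : k[X], pz p * gen _ g = gen _ g * pz (p.comp (X - C c))) →
      ∀ (m : ℕ) (p : k[X]), pz p * gen (X ^ 2) g ^ m
        = gen _ g ^ m * pz (p.comp (X - C (m * c : k))) := by
    intro g c h m
    induction m with
    | zero => intro p; simp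
    | succ m ih =>
      intro p
      have h1 : (X - C ((m : k) * c)).comp (X - C c) = X - C (((m + 1 : ℕ) : k) * c) := by
        simp only [sub_comp, X_comp, C_comp, Nat.cast_add, Nat.cast_one, add_mul, one_mul, C_add]
        abel
      rw [pow_succ (gen _ g) m, ← mul_assoc, ih, mul_assoc, h, ← mul_assoc, comp_assoc, h1]
  rw [regW]
  split_ifs with h
  · rw [hp .x 1 (fun p => by rw [pz_mul_x, map_one])]
    congr 4
    rw [mul_one, ← Int.cast_natCast, Int.toNat_of_nonneg h]
  · rw [hp .y (-1) (fun p => by rw [pz_mul_y, map_neg, map_one, sub_neg_eq_add])]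
    congr 4
    rw [mul_neg, mul_one, ← Int.cast_natCast, Int.toNat_of_nonneg (by omega)]
    push_cast; ring

theorem pz_mul_injective {p : k[X]} (hp : p ≠ 0) {a : A k} (h : pz p * a = 0) : a = 0 := by
  have : a ∈ (⊥ : Submodule k (regA k)) := by
    refine (regA k).mem_of_proj _ a fun i => ?_
    change GrMod.regProj i a ∈ (⊥ : Submodule k (A k))
    have h0 : pz p * GrMod.regProj i a = 0 := by
      have := GrMod.regProj_mul (pz_mem p) i a
      rw [h, map_zero, sub_zero] at this
      exact this.symm
    obtain ⟨q, hq⟩ := regW_span i _ (GrMod.regProj_mem i a)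
    rw [hq, ← mul_assoc, pz_mul_regW, mul_assoc, ← pz_mul] at h0
    have h1 := regW_free i _ h0
    have h2 : p.comp (X - C (i : k)) ≠ 0 := by
      intro h3
      rw [comp_eq_zero_iff] at h3
      rcases h3 with h3 | ⟨-, h3⟩
      · exact hp h3
      · have := congrArg (fun r => coeff r 1) h3
        simp at this
    rw [hq, (mul_eq_zero.1 h1).resolve_left h2]
    simp [pz]
  exact (Submodule.mem_bot k).1 this

end Ladder

section InvLadder

variable {k : Type u} [Field k]

/-- The polynomial `(z + n - i)²`, which acts on the right on degree `i` elements as `(z + n)²`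
does on the left. -/
def qPoly (n i : ℤ) : k[X] := (X + C ((n - i : ℤ) : k)) ^ 2

theorem qPoly_comp_sub (n i : ℤ) : (qPoly n i : k[X]).comp (X - 1) = qPoly n (i + 1) := by
  simp [qPoly, sub_eq_add_neg, add_assoc, add_comm]

theorem qPoly_comp_add (n i : ℤ) : (qPoly n (i + 1) : k[X]).comp (X + 1) = qPoly n i := by
  rw [← qPoly_comp_sub, comp_assoc]; simp

theorem qPoly_ne_zero (n i : ℤ) : (qPoly n i : k[X]) ≠ 0 :=
  pow_ne_zero _ (X_add_C_ne_zero _)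

theorem qPoly_self (n : ℤ) : (qPoly n n : k[X]) = X ^ 2 := by simp [qPoly]

theorem qPoly_succ (n : ℤ) : (qPoly n (n + 1) : k[X]) = (X - 1) ^ 2 := by
  simp [qPoly, sub_eq_add_neg]

theorem isCoprime_add_C {a b : k} (h : a ≠ b) : IsCoprime ((X + C a) ^ 2) ((X + C b) ^ 2) := by
  refine IsCoprime.pow ?_
  have := isCoprime_X_sub_C_of_isUnit_sub (R := k) (a := -a) (b := -b)
    (isUnit_iff_ne_zero.2 (by rw [sub_ne_zero]; simpa using h))
  simpa using this

theorem eq_zero_of_coprime {M : GrA k} {m : M} {p q : k[X]} (h : IsCoprime p q)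
    (hp : ra m (pz p) = 0) (hq : ra m (pz q) = 0) : m = 0 := by
  obtain ⟨a, b, hab⟩ := h
  rw [← ra_one m, ← pz_one, ← hab, mul_comm a, mul_comm b, pz, map_add, ra_add]
  change ra m (pz (p * a)) + ra m (pz (q * b)) = 0
  rw [← ra_pz_pz, ← ra_pz_pz, hp, hq, zero_ra, zero_ra, add_zero]

/-- The degree `i` part of the module is killed by `qPoly n i`. -/
def Killed (n : ℤ) (T : GrA k) : Prop := ∀ i, ∀ t ∈ T.deg i, ra t (pz (qPoly n i)) = 0

/-- The class in the cyclic module `A/gA`. -/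
theorem cyclic_zero (g : Gen) (a : A k) :
    (Submodule.span (A k)ᵐᵒᵖ {(gen _ g : A k)}).mkQ (gen _ g * a) = 0 := by
  rw [Submodule.mkQ_apply, Submodule.Quotient.mk_eq_zero]
  exact Submodule.mem_span_singleton.2 ⟨MulOpposite.op a, rfl⟩

theorem mul_qPoly {i : ℤ} {a : A k} (ha : a ∈ grade (X ^ 2 : k[X]) i) (p q : k[X])
    (h : q.comp (X - C (i : k)) = p) : a * pz p = pz q * a := by
  obtain ⟨r, rfl⟩ := regW_span i a ha
  rw [← mul_assoc (pz q), pz_mul_regW, h, mul_assoc, pz_comm, mul_assoc]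

theorem killed_X (n : ℤ) : Killed n (indecX k n) := by
  rintro i _ ⟨(a : A k), ha, rfl⟩
  change (Submodule.span (A k)ᵐᵒᵖ {(gen _ .x : A k)}).mkQ ((a : A k) * pz (qPoly n i)) = 0
  rw [mul_qPoly ha _ (X ^ 2) (by
    simp only [qPoly, pow_comp, X_comp, Int.cast_sub, C_sub]
    ring), ← x_mul_y, mul_assoc]
  exact cyclic_zero .x _

theorem killed_Y (n : ℤ) : Killed n (indecY k n) := by
  rintro i _ ⟨(a : A k), ha, rfl⟩
  change (Submodule.span (A k)ᵐᵒᵖ {(gen _ .y : A k)}).mkQ ((a : A k) * pz (qPoly n i)) = 0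
  rw [mul_qPoly ha _ ((X - 1) ^ 2) (by
    simp only [qPoly, pow_comp, sub_comp, X_comp, one_comp, Int.cast_sub, Int.cast_add,
      Int.cast_one, C_sub, C_add, C_1]
    ring), ← y_mul_x, mul_assoc]
  exact cyclic_zero .y _

theorem indecX_eq_zero {n i : ℤ} (h : n < i) {t : indecX k n} (ht : t ∈ (indecX k n).deg i) :
    t = 0 := by
  obtain ⟨(a : A k), ha, rfl⟩ := ht
  obtain ⟨r, hr⟩ := regW_span (i - n) a ha
  change (Submodule.span (A k)ᵐᵒᵖ {(gen _ .x : A k)}).mkQ (a : A k) = 0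
  rw [hr, regW, if_pos (by omega), show (i - n).toNat = (i - n - 1).toNat + 1 by omega,
    pow_succ' (gen _ .x) (i - n - 1).toNat, mul_assoc]
  exact cyclic_zero .x _

theorem indecY_eq_zero {n i : ℤ} (h : i ≤ n) {t : indecY k n} (ht : t ∈ (indecY k n).deg i) :
    t = 0 := by
  obtain ⟨(a : A k), ha, rfl⟩ := ht
  obtain ⟨r, hr⟩ := regW_span (i - (n + 1)) a ha
  change (Submodule.span (A k)ᵐᵒᵖ {(gen _ .y : A k)}).mkQ (a : A k) = 0
  rw [hr, regW, if_neg (by omega), show (-(i - (n + 1))).toNat = (n - i).toNat + 1 by omega,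
    pow_succ' (gen _ .y) (n - i).toNat, mul_assoc]
  exact cyclic_zero .y _

/-- Switch the value at `n`. -/
def flip (s : ℤ → Bool) (n : ℤ) : ℤ → Bool := fun i => if i = n then !s i else s i

variable (k) in
/-- The polynomial by which the generator of degree `i` is multiplied in passing to `ι_n`. -/
def fac (n : ℤ) (b : Bool) (i : ℤ) : k[X] :=
  if (decide (i ≤ n)) = b then qPoly n i else 1

theorem fac_ne_zero (n : ℤ) (b : Bool) (i : ℤ) : fac k n b i ≠ 0 := by
  rw [fac]; split_ifs
  · exact qPoly_ne_zero n i
  · exact one_ne_zero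

theorem fac_mul_fac (n : ℤ) (b : Bool) (i : ℤ) : fac k n b i * fac k n (!b) i = qPoly n i := by
  rw [fac, fac]; cases b <;> by_cases h : i ≤ n <;> simp [h]

theorem fac_comp_sub {n i : ℤ} (b : Bool) (h : i ≠ n) :
    (fac k n b i).comp (X - 1) = fac k n b (i + 1) := by
  rw [fac, fac]
  have : decide (i ≤ n) = decide (i + 1 ≤ n) := by
    rw [decide_eq_decide]; omega
  rw [this]; split_ifs
  · exact qPoly_comp_sub n i
  · simp

theorem fac_comp_add {n i : ℤ} (b : Bool) (h : i ≠ n) :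
    (fac k n b (i + 1)).comp (X + 1) = fac k n b i := by
  rw [← fac_comp_sub b h, comp_assoc]; simp

variable [CharZero k]

theorem qPoly_coprime_X {n i : ℤ} (h : i ≠ n) : IsCoprime (X ^ 2 : k[X]) (qPoly n i) := by
  have := isCoprime_add_C (k := k) (a := 0) (b := ((n - i : ℤ) : k))
    (by
      intro h0
      exact h (by have := Int.cast_eq_zero.1 h0.symm; omega))
  simpa [qPoly] using this

theorem qPoly_coprime_X_sub {n i : ℤ} (h : i ≠ n + 1) :
    IsCoprime ((X - 1) ^ 2 : k[X]) (qPoly n i) := by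
  have := isCoprime_add_C (k := k) (a := -1) (b := ((n - i : ℤ) : k))
    (by
      intro h0
      have h1 : ((n - i + 1 : ℤ) : k) = 0 := by push_cast at h0 ⊢; rw [← h0]; ring
      exact h (by have := Int.cast_eq_zero.1 h1; omega))
  rwa [map_neg, map_one, ← sub_eq_add_neg] at this

theorem up_zero {n : ℤ} {M T : GrA k} (hT : Killed n T) {s : ℤ → Bool} {w : ℤ → M}
    (h : IsLadder M s w) (φ : M ⟶ T) {i : ℤ} (hi : i ≠ n ∨ s i = true) (h0 : φ.1 (w i) = 0) :
    φ.1 (w (i + 1)) = 0 := by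
  cases hs : s i with
  | true => rw [← h.up i hs, map_ra, h0, zero_ra]
  | false =>
    refine eq_zero_of_coprime (qPoly_coprime_X_sub (n := n) (i := i + 1) ?_) ?_
      (hT (i + 1) _ (φ.2 _ _ (h.mem (i + 1))))
    · rw [hs] at hi; simpa using hi
    · rw [← ra_yx, ← map_ra, h.down i hs, h0, zero_ra]

theorem down_zero {n : ℤ} {M T : GrA k} (hT : Killed n T) {s : ℤ → Bool} {w : ℤ → M}
    (h : IsLadder M s w) (φ : M ⟶ T) {i : ℤ} (hi : i ≠ n ∨ s i = false)
    (h0 : φ.1 (w (i + 1)) = 0) : φ.1 (w i) = 0 := by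
  cases hs : s i with
  | false => rw [← h.down i hs, map_ra, h0, zero_ra]
  | true =>
    refine eq_zero_of_coprime (qPoly_coprime_X (n := n) (i := i) ?_) ?_
      (hT i _ (φ.2 _ _ (h.mem i)))
    · rw [hs] at hi; simpa using hi
    · rw [← ra_xy, ← map_ra, h.up i hs, h0, zero_ra]

theorem vanish_Y {n : ℤ} {M : GrA k} {s : ℤ → Bool} {w : ℤ → M} (h : IsLadder M s w)
    (hs : s n = true) (φ : M ⟶ indecY k n) (i : ℤ) : φ.1 (w i) = 0 := by
  by_cases hi : i ≤ n
  · exact indecY_eq_zero hi (φ.2 _ _ (h.mem i))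
  · obtain ⟨m, rfl⟩ : ∃ m : ℕ, i = n + m := ⟨(i - n).toNat, by omega⟩
    clear hi
    induction m with
    | zero => exact indecY_eq_zero (by simp) (φ.2 _ _ (h.mem _))
    | succ m ih =>
      have := up_zero (killed_Y n) h φ (i := n + m) ?_ ih
      · rwa [Nat.cast_succ, ← add_assoc]
      · by_cases hm : m = 0
        · right; simpa [hm] using hs
        · left; omega

theorem vanish_X {n : ℤ} {M : GrA k} {s : ℤ → Bool} {w : ℤ → M} (h : IsLadder M s w)
    (hs : s n = false) (φ : M ⟶ indecX k n) (i : ℤ) : φ.1 (w i) = 0 := by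
  by_cases hi : n < i
  · exact indecX_eq_zero hi (φ.2 _ _ (h.mem i))
  · obtain ⟨m, rfl⟩ : ∃ m : ℕ, i = n + 1 - m := ⟨(n + 1 - i).toNat, by omega⟩
    clear hi
    induction m with
    | zero => exact indecX_eq_zero (by simp) (φ.2 _ _ (h.mem _))
    | succ m ih =>
      refine down_zero (killed_X n) h φ (i := n + 1 - (m + 1 : ℕ)) ?_ ?_
      · by_cases hm : m = 0
        · right; simpa [hm] using hs
        · left; omega
      · rwa [Nat.cast_succ, show n + 1 - ((m : ℤ) + 1) + 1 = n + 1 - m by ring]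

/-- For `s n`, there is a homomorphism to `(A/xA)⟨n⟩` with the expected kernel. -/
theorem exists_hom_X {n : ℤ} {M : GrA k} {s : ℤ → Bool} {w : ℤ → M} (h : IsLadder M s w)
    (hs : s n = true) : ∃ φ : M ⟶ indecX k n, ∀ i ≤ n, ∀ p,
      φ.1 (ra (w i) (pz p)) = 0 → qPoly n i ∣ p := by
  let T := indecX k n
  have step : ∀ i, i < n → ∀ t : T, t ∈ T.deg (i + 1) → ∃ u : T, u ∈ T.deg i ∧
      (s i = true → ra u (gen _ .x) = t) ∧ (s i = false → ra t (gen _ .y) = u) := by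
    intro i hi t ht
    cases s i with
    | false => exact ⟨_, ra_y_mem ht, by simp, by simp⟩
    | true =>
      obtain ⟨a, b, hab⟩ := qPoly_coprime_X_sub (k := k) (n := n) (i := i + 1) (by omega)
      refine ⟨ra (ra t (gen _ .y)) (pz (a.comp (X + 1))), ra_pz_mem (ra_y_mem ht) _, ?_, by simp⟩
      intro _
      have h1 : (a.comp (X + 1)).comp (X - 1) = a := by rw [comp_assoc]; simp
      have h2 : (X - 1) ^ 2 * a = 1 - qPoly n (i + 1) * b := by linear_combination hab
      have h3 : ra t (pz (qPoly n (i + 1) * b)) = 0 := by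
        rw [← ra_pz_pz, killed_X n _ t ht, zero_ra]
      rw [ra_pz_x, ra_yx, ra_pz_pz, h1, h2]
      have h4 : ra t (pz (1 - qPoly n (i + 1) * b)) + ra t (pz (qPoly n (i + 1) * b)) = t := by
        rw [← ra_add, ← pz_add, sub_add_cancel, pz_one, ra_one]
      rwa [h3, add_zero] at h4
  choose! d hd1 hd2 hd3 using step
  let t0 : T := (Submodule.span (A k)ᵐᵒᵖ {(gen _ .x : A k)}).mkQ (1 : A k)
  have ht0 : t0 ∈ T.deg n :=
    ⟨(1 : A k), by rw [sub_self]; exact one_mem_grade _, rfl⟩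
  let t' : ℕ → T := fun m => Nat.rec t0 (fun m t => d (n - (m + 1 : ℕ)) t) m
  have ht' : ∀ m : ℕ, t' m ∈ T.deg (n - m) := by
    intro m
    induction m with
    | zero => rw [Nat.cast_zero, sub_zero]; exact ht0
    | succ m ih =>
      refine hd1 _ (by omega) _ ?_
      rwa [Nat.cast_succ, show n - ((m : ℤ) + 1) + 1 = n - m by ring]
  have hup : ∀ m : ℕ, s (n - (m + 1 : ℕ)) = true → ra (t' (m + 1)) (gen _ .x) = t' m := by
    intro m
    refine hd2 _ (by omega) _ ?_
    rw [Nat.cast_succ, show n - ((m : ℤ) + 1) + 1 = n - m by ring]; exact ht' m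
  have hdown : ∀ m : ℕ, s (n - (m + 1 : ℕ)) = false → ra (t' m) (gen _ .y) = t' (m + 1) := by
    intro m
    refine hd3 _ (by omega) _ ?_
    rw [Nat.cast_succ, show n - ((m : ℤ) + 1) + 1 = n - m by ring]; exact ht' m
  have hann : ∀ (m : ℕ) (p : k[X]), ra (t' m) (pz p) = 0 → qPoly n (n - m) ∣ p := by
    intro m
    induction m with
    | zero =>
      intro p hp
      change (Submodule.span (A k)ᵐᵒᵖ {(gen _ .x : A k)}).mkQ ((1 : A k) * pz p) = 0 at hp
      rw [one_mul, Submodule.mkQ_apply, Submodule.Quotient.mk_eq_zero] at hp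
      obtain ⟨a, ha⟩ := Submodule.mem_span_singleton.1 hp
      change gen _ .x * a.unop = pz p at ha
      have h1 := GrMod.regProj_mul (gen_mem (X ^ 2 : k[X]) .x) 0 a.unop
      rw [ha, GrMod.regProj_same (pz_mem p)] at h1
      obtain ⟨q, hq⟩ := regW_span _ _ (GrMod.regProj_mem (0 - Gen.x.deg) a.unop)
      rw [hq, show regW (0 - Gen.x.deg) = (gen _ .y : A k) by simp [regW, Gen.deg], ← mul_assoc,
        x_mul_y, ← pz_mul] at h1
      have h2 := regW_free 0 (p - X ^ 2 * q)
        (by rw [regW_zero, one_mul, pz, map_sub, sub_eq_zero]; exact h1)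
      rw [Nat.cast_zero, sub_zero, qPoly_self]
      exact ⟨q, sub_eq_zero.1 h2⟩
    | succ m ih =>
      intro p hp
      have e : n - ((m + 1 : ℕ) : ℤ) + 1 = n - m := by push_cast; ring
      have key : qPoly n (n - m) ∣ p.comp (X - 1) := by
        cases hsm : s (n - (m + 1 : ℕ)) with
        | true =>
          apply ih
          rw [← hup m hsm, ← ra_pz_x, hp, zero_ra]
        | false =>
          have : qPoly n (n - m) ∣ (X - 1) ^ 2 * p.comp (X - 1) := by
            apply ih
            rw [← ra_pz_pz, ← ra_yx, hdown m hsm, ← ra_pz_x, hp, zero_ra]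
          exact (qPoly_coprime_X_sub (by omega)).symm.dvd_of_dvd_mul_left this
      obtain ⟨r, hr⟩ := key
      refine ⟨r.comp (X + 1), ?_⟩
      have : (p.comp (X - 1)).comp (X + 1) = p := by rw [comp_assoc]; simp
      rw [← this, hr, mul_comp, ← e, qPoly_comp_add]
  let t : ℤ → T := fun i => if i ≤ n then t' (n - i).toNat else 0
  obtain ⟨φ, hφ⟩ := h.exists_hom t (by
      intro i
      simp only [t]
      split_ifs with hi
      · have := ht' (n - i).toNat
        rwa [Int.toNat_of_nonneg (by omega), show n - (n - i) = i by ring] at this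
      · exact zero_mem _) (by
      intro i hi
      rcases lt_trichotomy i n with h1 | h1 | h1
      · simp only [t]
        rw [if_pos h1.le, if_pos (by omega), show (n - i).toNat = (n - (i + 1)).toNat + 1 by omega]
        apply hup
        convert hi using 2
        omega
      · subst h1
        simp only [t, le_refl, if_true]
        rw [if_neg (by omega)]
        refine indecX_eq_zero (lt_add_one i) (ra_x_mem ?_)
        simpa using ht' 0
      · simp only [t]
        rw [if_neg (by omega), if_neg (by omega), zero_ra]) (by
      intro i hi
      rcases lt_trichotomy i n with h1 | h1 | h1
      · simp only [t]
        rw [if_pos h1.le, if_pos (by omega), show (n - i).toNat = (n - (i + 1)).toNat + 1 by omega]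
        apply hdown
        convert hi using 2
        omega
      · subst h1; rw [hs] at hi; simp at hi
      · simp only [t]
        rw [if_neg (by omega), if_neg (by omega), zero_ra])
  refine ⟨φ, fun i hi p hp => ?_⟩
  rw [map_ra, hφ] at hp
  simp only [t, if_pos hi] at hp
  have := hann _ _ hp
  rwa [Int.toNat_of_nonneg (by omega), show n - (n - i) = i by ring] at this

/-- For `¬ s n`, there is a homomorphism to `(A/yA)⟨n+1⟩` with the expected kernel. -/
theorem exists_hom_Y {n : ℤ} {M : GrA k} {s : ℤ → Bool} {w : ℤ → M} (h : IsLadder M s w)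
    (hs : s n = false) : ∃ φ : M ⟶ indecY k n, ∀ i, n < i → ∀ p,
      φ.1 (ra (w i) (pz p)) = 0 → qPoly n i ∣ p := by
  let T := indecY k n
  have step : ∀ i, n < i → ∀ t : T, t ∈ T.deg i → ∃ u : T, u ∈ T.deg (i + 1) ∧
      (s i = true → ra t (gen _ .x) = u) ∧ (s i = false → ra u (gen _ .y) = t) := by
    intro i hi t ht
    cases s i with
    | true => exact ⟨_, ra_x_mem ht, by simp, by simp⟩
    | false =>
      obtain ⟨a, b, hab⟩ := qPoly_coprime_X (k := k) (n := n) (i := i) (by omega)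
      refine ⟨ra (ra t (gen _ .x)) (pz (a.comp (X - 1))), ra_pz_mem (ra_x_mem ht) _, by simp, ?_⟩
      intro _
      have h1 : (a.comp (X - 1)).comp (X + 1) = a := by rw [comp_assoc]; simp
      have h2 : X ^ 2 * a = 1 - qPoly n i * b := by linear_combination hab
      have h3 : ra t (pz (qPoly n i * b)) = 0 := by
        rw [← ra_pz_pz, killed_Y n _ t ht, zero_ra]
      rw [ra_pz_y, ra_xy, ra_pz_pz, h1, h2]
      have h4 : ra t (pz (1 - qPoly n i * b)) + ra t (pz (qPoly n i * b)) = t := by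
        rw [← ra_add, ← pz_add, sub_add_cancel, pz_one, ra_one]
      rwa [h3, add_zero] at h4
  choose! d hd1 hd2 hd3 using step
  let t0 : T := (Submodule.span (A k)ᵐᵒᵖ {(gen _ .y : A k)}).mkQ (1 : A k)
  have ht0 : t0 ∈ T.deg (n + 1) :=
    ⟨(1 : A k), by rw [sub_self]; exact one_mem_grade _, rfl⟩
  let t' : ℕ → T := fun m => Nat.rec t0 (fun m t => d (n + 1 + m) t) m
  have ht' : ∀ m : ℕ, t' m ∈ T.deg (n + 1 + m) := by
    intro m
    induction m with
    | zero => rw [Nat.cast_zero, add_zero]; exact ht0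
    | succ m ih =>
      rw [Nat.cast_succ, ← add_assoc]
      exact hd1 _ (by omega) _ ih
  have hup : ∀ m : ℕ, s (n + 1 + m) = true → ra (t' m) (gen _ .x) = t' (m + 1) :=
    fun m => hd2 _ (by omega) _ (ht' m)
  have hdown : ∀ m : ℕ, s (n + 1 + m) = false → ra (t' (m + 1)) (gen _ .y) = t' m :=
    fun m => hd3 _ (by omega) _ (ht' m)
  have hann : ∀ (m : ℕ) (p : k[X]), ra (t' m) (pz p) = 0 → qPoly n (n + 1 + m) ∣ p := by
    intro m
    induction m with
    | zero =>
      intro p hp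
      change (Submodule.span (A k)ᵐᵒᵖ {(gen _ .y : A k)}).mkQ ((1 : A k) * pz p) = 0 at hp
      rw [one_mul, Submodule.mkQ_apply, Submodule.Quotient.mk_eq_zero] at hp
      obtain ⟨a, ha⟩ := Submodule.mem_span_singleton.1 hp
      change gen _ .y * a.unop = pz p at ha
      have h1 := GrMod.regProj_mul (gen_mem (X ^ 2 : k[X]) .y) 0 a.unop
      rw [ha, GrMod.regProj_same (pz_mem p)] at h1
      obtain ⟨q, hq⟩ := regW_span _ _ (GrMod.regProj_mem (0 - Gen.y.deg) a.unop)
      rw [hq, show regW (0 - Gen.y.deg) = (gen _ .x : A k) by simp [regW, Gen.deg], ← mul_assoc,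
        y_mul_x, ← pz_mul] at h1
      have h2 := regW_free 0 (p - (X - 1) ^ 2 * q)
        (by rw [regW_zero, one_mul, pz, map_sub, sub_eq_zero]; exact h1)
      rw [Nat.cast_zero, add_zero, qPoly_succ]
      exact ⟨q, sub_eq_zero.1 h2⟩
    | succ m ih =>
      intro p hp
      have key : qPoly n (n + 1 + m) ∣ p.comp (X + 1) := by
        cases hsm : s (n + 1 + m) with
        | false =>
          apply ih
          rw [← hdown m hsm, ← ra_pz_y, hp, zero_ra]
        | true =>
          have : qPoly n (n + 1 + m) ∣ X ^ 2 * p.comp (X + 1) := by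
            apply ih
            rw [← ra_pz_pz, ← ra_xy, hup m hsm, ← ra_pz_y, hp, zero_ra]
          exact (qPoly_coprime_X (by omega)).symm.dvd_of_dvd_mul_left this
      obtain ⟨r, hr⟩ := key
      refine ⟨r.comp (X - 1), ?_⟩
      have : (p.comp (X + 1)).comp (X - 1) = p := by rw [comp_assoc]; simp
      rw [← this, hr, mul_comp, Nat.cast_succ, ← add_assoc, qPoly_comp_sub]
  let t : ℤ → T := fun i => if n < i then t' (i - (n + 1)).toNat else 0
  obtain ⟨φ, hφ⟩ := h.exists_hom t (by
      intro i
      simp only [t]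
      split_ifs with hi
      · have := ht' (i - (n + 1)).toNat
        rwa [Int.toNat_of_nonneg (by omega), show n + 1 + (i - (n + 1)) = i by ring] at this
      · exact zero_mem _) (by
      intro i hi
      rcases lt_trichotomy i n with h1 | h1 | h1
      · simp only [t]
        rw [if_neg (by omega), if_neg (by omega), zero_ra]
      · subst h1; rw [hs] at hi; simp at hi
      · simp only [t]
        rw [if_pos h1, if_pos (by omega),
          show (i + 1 - (n + 1)).toNat = (i - (n + 1)).toNat + 1 by omega]
        apply hup
        convert hi using 2
        omega) (by
      intro i hi
      rcases lt_trichotomy i n with h1 | h1 | h1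
      · simp only [t]
        rw [if_neg (by omega), if_neg (by omega), zero_ra]
      · subst h1
        simp only [t, lt_irrefl, if_false]
        rw [if_pos (by omega)]
        refine indecY_eq_zero le_rfl (ra_y_mem ?_)
        rw [sub_self]
        simpa using ht' 0
      · simp only [t]
        rw [if_pos h1, if_pos (by omega),
          show (i + 1 - (n + 1)).toNat = (i - (n + 1)).toNat + 1 by omega]
        apply hdown
        convert hi using 2
        omega)
  refine ⟨φ, fun i hi p hp => ?_⟩
  rw [map_ra, hφ] at hp
  simp only [t, if_pos hi] at hp
  have := hann _ _ hp
  rwa [Int.toNat_of_nonneg (by omega), show n + 1 + (i - (n + 1)) = i by ring] at this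

/-! #### The ladders of `ι_n M` and of `ι_J A` -/

theorem mem_invSub {n : ℤ} {M : GrA k} {s : ℤ → Bool} {w : ℤ → M} (h : IsLadder M s w)
    (i : ℤ) : ra (w i) (pz (fac k n (s n) i)) ∈ invSub n M := by
  cases hs : s n with
  | true =>
    refine ⟨GrMod.mem_reject.2 fun φ => ?_, GrMod.mem_reject.2 fun φ => ?_⟩
    · rw [map_ra]
      by_cases hi : i ≤ n
      · rw [fac, if_pos (by simpa using hi)]
        exact killed_X n i _ (φ.2 _ _ (h.mem i))
      · rw [indecX_eq_zero (not_le.1 hi) (φ.2 _ _ (h.mem i)), zero_ra]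
    · rw [map_ra, vanish_Y h hs, zero_ra]
  | false =>
    refine ⟨GrMod.mem_reject.2 fun φ => ?_, GrMod.mem_reject.2 fun φ => ?_⟩
    · rw [map_ra, vanish_X h hs, zero_ra]
    · rw [map_ra]
      by_cases hi : i ≤ n
      · rw [indecY_eq_zero hi (φ.2 _ _ (h.mem i)), zero_ra]
      · rw [fac, if_pos (by simpa using hi)]
        exact killed_Y n i _ (φ.2 _ _ (h.mem i))

theorem dvd_of_mem_invSub {n : ℤ} {M : GrA k} {s : ℤ → Bool} {w : ℤ → M} (h : IsLadder M s w)
    {i : ℤ} {p : k[X]} (hp : ra (w i) (pz p) ∈ invSub n M) : fac k n (s n) i ∣ p := by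
  rw [fac]
  split_ifs with hi
  · cases hs : s n with
    | true =>
      obtain ⟨φ, hφ⟩ := exists_hom_X h hs
      rw [hs] at hi
      exact hφ i (by simpa using hi) p (GrMod.mem_reject.1 hp.1 φ)
    | false =>
      obtain ⟨φ, hφ⟩ := exists_hom_Y h hs
      rw [hs] at hi
      exact hφ i (by simpa using hi) p (GrMod.mem_reject.1 hp.2 φ)
  · exact one_dvd _

theorem isLadder_inv {n : ℤ} {M : GrA k} {s : ℤ → Bool} {w : ℤ → M} (h : IsLadder M s w) :
    IsLadder ((inv k n).obj M) (flip s n)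
      (fun i => (⟨ra (w i) (pz (fac k n (s n) i)), mem_invSub h i⟩ : invSub n M)) where
  mem i := ra_pz_mem (h.mem i) _
  span := by
    rintro i ⟨m, hm⟩ (hmi : m ∈ M.deg i)
    obtain ⟨p, rfl⟩ := h.span i m hmi
    obtain ⟨q, rfl⟩ := dvd_of_mem_invSub h hm
    exact ⟨q, Subtype.ext (ra_pz_pz _ _ _).symm⟩
  free i p hp := by
    have h1 : ra (ra (w i) (pz (fac k n (s n) i))) (pz p) = 0 := congrArg Subtype.val hp
    rw [ra_pz_pz] at h1
    exact (mul_eq_zero.1 (h.free _ _ h1)).resolve_left (fac_ne_zero _ _ _)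
  up i hi := by
    refine Subtype.ext ?_
    change ra (ra (w i) (pz (fac k n (s n) i))) (gen _ .x)
      = ra (w (i + 1)) (pz (fac k n (s n) (i + 1)))
    rw [flip] at hi
    by_cases hin : i = n
    · subst hin
      have hs : s i = false := by simpa using hi
      rw [hs, ra_pz_x, ← h.down i hs, ra_yx, ra_pz_pz]
      simp [fac, qPoly_succ]
    · rw [if_neg hin] at hi
      rw [ra_pz_x, h.up i hi, fac_comp_sub _ hin]
  down i hi := by
    refine Subtype.ext ?_
    change ra (ra (w (i + 1)) (pz (fac k n (s n) (i + 1)))) (gen _ .y)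
      = ra (w i) (pz (fac k n (s n) i))
    rw [flip] at hi
    by_cases hin : i = n
    · subst hin
      have hs : s i = true := by simpa using hi
      rw [hs, ra_pz_y, ← h.up i hs, ra_xy, ra_pz_pz]
      simp [fac, qPoly_self]
    · rw [if_neg hin] at hi
      rw [ra_pz_y, h.down i hi, fac_comp_add _ hin]

end InvLadder

section ListLadder

variable {k : Type u} [Field k]

/-- Switch the values at the members of a list. -/
def flips (s : ℤ → Bool) : List ℤ → (ℤ → Bool)
  | [] => s
  | n :: L => flip (flips s L) n

variable (k) in
/-- The polynomial by which the generator of degree `i` is multiplied in passing to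
`ι_{n₁} ι_{n₂} ⋯`. -/
def facs (s : ℤ → Bool) : List ℤ → ℤ → k[X]
  | [], _ => 1
  | n :: L, i => facs s L i * fac k n (flips s L n) i

theorem flip_comm (s : ℤ → Bool) (a b : ℤ) : flip (flip s a) b = flip (flip s b) a := by
  funext i; simp only [flip]; split_ifs <;> rfl

theorem flip_flip (s : ℤ → Bool) (a : ℤ) : flip (flip s a) a = s := by
  funext i; simp only [flip]; split_ifs <;> simp

theorem flips_facs_perm (s : ℤ → Bool) {L L' : List ℤ} (h : L.Perm L') :
    flips s L = flips s L' ∧ ∀ i, facs k s L i = facs k s L' i := by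
  induction h with
  | nil => exact ⟨rfl, fun _ => rfl⟩
  | cons a _ ih => simp only [flips, facs, ih.1, ih.2, true_and, implies_true]
  | trans _ _ h1 h2 => exact ⟨h1.1.trans h2.1, fun i => (h1.2 i).trans (h2.2 i)⟩
  | swap a b L =>
    refine ⟨flip_comm _ _ _, fun i => ?_⟩
    by_cases hab : a = b
    · rw [hab]
    · simp only [facs, flips, flip, if_neg hab, if_neg (Ne.symm hab)]
      ring

theorem flips_append (s : ℤ → Bool) (L L' : List ℤ) :
    flips s (L ++ L') = flips (flips s L') L := by
  induction L with
  | nil => rfl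
  | cons a L ih => simp only [List.cons_append, flips, ih]

theorem facs_append (s : ℤ → Bool) (L L' : List ℤ) (i : ℤ) :
    facs k s (L ++ L') i = facs k s L' i * facs k (flips s L') L i := by
  induction L with
  | nil => simp [facs]
  | cons a L ih => simp only [List.cons_append, facs, ih, flips_append, mul_assoc]

theorem facs_double (s : ℤ → Bool) (K L : List ℤ) :
    flips s (K ++ K ++ L) = flips s L ∧
      ∀ i, facs k s (K ++ K ++ L) i = (K.map fun n => qPoly n i).prod * facs k s L i := by
  induction K with
  | nil => simp
  | cons n K ih =>
    have hp : (n :: K ++ n :: K ++ L).Perm (n :: n :: (K ++ K ++ L)) := by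
      simp only [List.cons_append, List.append_assoc]
      exact (List.perm_middle).cons n
    obtain ⟨h1, h2⟩ := flips_facs_perm (k := k) s hp
    refine ⟨?_, fun i => ?_⟩
    · rw [h1, flips, flips, flip_flip, ih.1]
    · rw [h2, facs, facs, flips, flip, if_pos rfl, mul_assoc, fac_mul_fac, ih.2, List.map_cons,
        List.prod_cons]
      ring

theorem sort_perm (I J : Finset ℤ) : (J.sort (· ≤ ·) ++ I.sort (· ≤ ·)).Perm
    ((I ∩ J).sort (· ≤ ·) ++ (I ∩ J).sort (· ≤ ·) ++ (symmDiff I J).sort (· ≤ ·)) := by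
  rw [← Multiset.coe_eq_coe]
  simp only [← Multiset.coe_add, Finset.sort_eq]
  ext a
  simp only [Multiset.count_add, Multiset.count_eq_of_nodup (Finset.nodup _), Finset.mem_val,
    Finset.mem_inter, Finset.mem_symmDiff]
  by_cases h1 : a ∈ I <;> by_cases h2 : a ∈ J <;> simp [h1, h2]

theorem prod_qPoly (K : Finset ℤ) (i : ℤ) :
    ((K.sort (· ≤ ·)).map fun n => (qPoly n i : k[X])).prod
      = (hPoly k K).comp (X - C (i : k)) := by
  have h1 : ((K.sort (· ≤ ·)).map fun n => (qPoly n i : k[X])).prod = ∏ n ∈ K, qPoly n i := by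
    rw [Finset.prod_eq_multiset_prod, ← Finset.sort_eq K (· ≤ ·), Multiset.map_coe,
      Multiset.prod_coe]
  rw [h1, hPoly, Polynomial.prod_comp]
  refine Finset.prod_congr rfl fun n _ => ?_
  simp only [qPoly, pow_comp, add_comp, X_comp, C_comp, Int.cast_sub, C_sub]
  ring

theorem hPoly_ne_zero (K : Finset ℤ) : hPoly k K ≠ 0 :=
  Finset.prod_ne_zero_iff.2 fun _ _ => pow_ne_zero _ (X_add_C_ne_zero _)

/-- In degree `0`, the generator of `A` is multiplied by `h_J` in passing to `ι_J A`. -/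
theorem facs_zero {L : List ℤ} (hL : L.Nodup) :
    (∀ n ∉ L, flips (fun i => decide (0 ≤ i)) L n = decide (0 ≤ n)) ∧
      facs k (fun i => decide (0 ≤ i)) L 0 = (L.map fun n : ℤ => (X + C (n : k)) ^ 2).prod := by
  induction L with
  | nil => exact ⟨fun _ _ => rfl, rfl⟩
  | cons n L ih =>
    obtain ⟨hn, hL⟩ := List.nodup_cons.1 hL
    obtain ⟨h1, h2⟩ := ih hL
    refine ⟨fun m hm => ?_, ?_⟩
    · rw [List.mem_cons, not_or] at hm
      rw [flips, flip, if_neg hm.1, h1 m hm.2]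
    · rw [facs, h2, h1 n hn, fac, if_pos rfl, List.map_cons, List.prod_cons, mul_comm]
      simp [qPoly]

theorem invListIncl_cons {M : GrA k} (n : ℤ) (L : List ℤ) (v : (invList (n :: L)).obj M) :
    ((invListIncl (n :: L)).app M).1 v
      = ((invListIncl L).app M).1 (((invIncl n).app ((invList L).obj M)).1 v) := rfl

theorem invListIncl_injective (M : GrA k) (L : List ℤ) :
    Function.Injective ((invListIncl L).app M).1 := by
  induction L with
  | nil => exact fun _ _ h => h
  | cons n L ih => exact fun a b h => Subtype.ext (ih h)

theorem invSetIncl_injective (M : GrA k) (J : ZFin) :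
    Function.Injective ((invSetIncl J).app M).1 := invListIncl_injective M _

/-- The inclusion of `ι_J A` into `A`. -/
def inclA (J : ZFin) (v : (invSet k J).obj (regA k)) : A k := ((invSetIncl J).app (regA k)).1 v

theorem inclA_injective (J : ZFin) : Function.Injective (inclA (k := k) J) :=
  invSetIncl_injective _ J

/-- Left multiplication by a polynomial in `z`. -/
def lmul (p : k[X]) : regA k ⟶ regA k :=
  ⟨{ toFun := fun a : A k => pz p * a
     map_add' := fun a b => mul_add (pz p) (a : A k) b
     map_smul' := fun c a => (mul_assoc (pz p) (a : A k) c.unop).symm },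
    fun i a ha => by
      have := mul_mem_grade (pz_mem p) ha
      rwa [zero_add] at this⟩

variable [CharZero k]

theorem exists_isLadder {M : GrA k} {s : ℤ → Bool} {w : ℤ → M} (h : IsLadder M s w)
    (L : List ℤ) : ∃ w', IsLadder ((invList L).obj M) (flips s L) w' ∧
      ∀ i, ((invListIncl L).app M).1 (w' i) = ra (w i) (pz (facs k s L i)) := by
  induction L with
  | nil => exact ⟨w, h, fun i => by rw [facs, pz_one, ra_one]; rfl⟩
  | cons n L ih =>
    obtain ⟨w', h1, h2⟩ := ih
    refine ⟨_, isLadder_inv (n := n) h1, fun i => ?_⟩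
    rw [facs, ← ra_pz_pz, ← h2]
    exact map_ra ((invListIncl L).app M) (w' i) _

/-- The isomorphism `Θ_{J,I}` exists. -/
theorem exists_theta (I J : ZFin) :
    ∃ Θ : (invSet k J).obj ((invSet k I).obj (regA k)) ≅ (invSet k (I + J)).obj (regA k),
      ∀ v : (invSet k J).obj ((invSet k I).obj (regA k)),
        pz (hPoly k (I.toFinset ∩ J.toFinset)) * inclA (I + J) (Θ.hom.1 v)
          = inclA I (((invSetIncl J).app ((invSet k I).obj (regA k))).1 v) := by
  obtain ⟨w1, h1, e1⟩ := exists_isLadder (isLadder_reg (k := k)) (I.toFinset.sort (· ≤ ·))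
  obtain ⟨w2, h2, e2⟩ := exists_isLadder h1 (J.toFinset.sort (· ≤ ·))
  obtain ⟨w3, h3, e3⟩ := exists_isLadder (isLadder_reg (k := k)) ((I + J).toFinset.sort (· ≤ ·))
  set s0 : ℤ → Bool := fun i => decide (0 ≤ i) with hs0
  obtain ⟨p1, p2⟩ := flips_facs_perm (k := k) s0 (show List.Perm _
    ((I.toFinset ∩ J.toFinset).sort (· ≤ ·) ++ (I.toFinset ∩ J.toFinset).sort (· ≤ ·) ++
      (I + J).toFinset.sort (· ≤ ·)) from sort_perm I.toFinset J.toFinset)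
  obtain ⟨d1, d2⟩ := facs_double (k := k) s0 ((I.toFinset ∩ J.toFinset).sort (· ≤ ·))
    ((I + J).toFinset.sort (· ≤ ·))
  rw [← flips_append, p1, d1] at h2
  obtain ⟨φ, hφ⟩ := h2.exists_hom w3 h3.mem h3.up h3.down
  obtain ⟨ψ, hψ⟩ := h3.exists_hom w2 h2.mem h2.up h2.down
  refine ⟨⟨φ, ψ, h2.hom_ext fun i => ?_, h3.hom_ext fun i => ?_⟩, ?_⟩
  · change ψ.1 (φ.1 (w2 i)) = w2 i
    rw [hφ, hψ]
  · change φ.1 (ψ.1 (w3 i)) = w3 i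
    rw [hψ, hφ]
  · intro v
    have key : φ ≫ (invSetIncl (I + J)).app (regA k) ≫ lmul (hPoly k (I.toFinset ∩ J.toFinset))
        = (invSetIncl J).app ((invSet k I).obj (regA k)) ≫ (invSetIncl I).app (regA k) := by
      refine h2.hom_ext fun i => ?_
      have l1 : ((invSetIncl I).app (regA k)).1
          (((invSetIncl J).app ((invSet k I).obj (regA k))).1 (w2 i))
          = ra (M := regA k) (regW i) (pz (facs k s0 (I.toFinset.sort (· ≤ ·)) i *
            facs k (flips s0 (I.toFinset.sort (· ≤ ·))) (J.toFinset.sort (· ≤ ·)) i)) :=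
        (congrArg ((invSetIncl I).app (regA k)).1 (e2 i)).trans
          ((map_ra ((invSetIncl I).app (regA k)) (w1 i) _).trans
            ((congrArg (fun m : regA k => ra m (pz _)) (e1 i)).trans (ra_pz_pz _ _ _)))
      have l2 : ((invSetIncl (I + J)).app (regA k)).1 (φ.1 (w2 i))
          = ra (M := regA k) (regW i) (pz (facs k s0 ((I + J).toFinset.sort (· ≤ ·)) i)) := by
        exact (congrArg ((invSetIncl (I + J)).app (regA k)).1 (hφ i)).trans (e3 i)
      change (lmul _).1 (((invSetIncl (I + J)).app (regA k)).1 (φ.1 (w2 i)))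
        = ((invSetIncl I).app (regA k)).1
          (((invSetIncl J).app ((invSet k I).obj (regA k))).1 (w2 i))
      refine (congrArg (lmul _).1 l2).trans (Eq.trans ?_ l1.symm)
      rw [← facs_append, p2, d2, prod_qPoly]
      change pz (hPoly k (I.toFinset ∩ J.toFinset)) *
        (regW i * pz (facs k s0 ((I + J).toFinset.sort (· ≤ ·)) i)) = regW i * pz _
      rw [← mul_assoc, pz_mul_regW, mul_assoc, ← pz_mul]
    exact DFunLike.congr_fun (congrArg Subtype.val key) v

end ListLadder

/-! ### The ring `B` -/

section RingB

variable (k : Type u) [Field k]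

/-- The homogeneous component `B_J = Hom_{gr A}(A, ι_J A)`. -/
def BPart (J : ZFin) : Type u := gradedHom (regA k) ((invSet k J).obj (regA k))

instance (J : ZFin) : AddCommGroup (BPart k J) :=
  inferInstanceAs (AddCommGroup (gradedHom (regA k) ((invSet k J).obj (regA k))))

instance (J : ZFin) : Module k (BPart k J) :=
  inferInstanceAs (Module k (gradedHom (regA k) ((invSet k J).obj (regA k))))

variable {k}

/-- An element of `B_J`, as a morphism of graded modules. -/
def BPart.hom {J : ZFin} (a : BPart k J) : regA k ⟶ (invSet k J).obj (regA k) := a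

/-- The element of `A` by which an element of `B_J` multiplies from the left. -/
def BPart.val {J : ZFin} (a : BPart k J) : A k := inclA J (a.hom.1 (1 : A k))

theorem BPart.hom_apply {J : ZFin} (a : BPart k J) (r : A k) :
    inclA J (a.hom.1 r) = a.val * r := by
  have h1 : a.hom.1 r = ra (a.hom.1 (1 : A k)) r :=
    (congrArg a.hom.1 (one_mul r).symm).trans (map_ra a.hom (1 : A k) r)
  rw [h1, BPart.val]
  exact map_ra ((invSetIncl J).app (regA k)) _ r

theorem BPart.val_injective {J : ZFin} {a b : BPart k J} (h : a.val = b.val) : a = b := by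
  refine Subtype.ext (LinearMap.ext fun (r : A k) => inclA_injective J ?_)
  exact (a.hom_apply r).trans ((congrArg (fun t : A k => t * r) h).trans (b.hom_apply r).symm)

theorem BPart.mk_eq {I J : ZFin} (h : I = J) {a : BPart k I} {b : BPart k J}
    (hv : a.val = b.val) : GradedMonoid.mk I a = GradedMonoid.mk J b := by
  subst h; rw [BPart.val_injective hv]

theorem BPart.val_add {J : ZFin} (a b : BPart k J) : (a + b).val = a.val + b.val :=
  map_add ((invSetIncl J).app (regA k)).1 _ _

theorem BPart.val_zero {J : ZFin} : (0 : BPart k J).val = 0 :=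
  map_zero ((invSetIncl J).app (regA k)).1

theorem BPart.val_smul {J : ZFin} (c : k) (a : BPart k J) : (c • a).val = c • a.val :=
  LinearMap.map_smul_of_tower ((invSetIncl J).app (regA k)).1 c _

theorem BPart.exists_val {J : ZFin} (a : BPart k J) : ∃ p : k[X], a.val = pz p := by
  have h : a.val ∈ grade (X ^ 2 : k[X]) 0 :=
    ((invSetIncl J).app (regA k)).2 0 _ (a.hom.2 0 _ (one_mem_grade _))
  obtain ⟨p, hp⟩ := regW_span 0 _ h
  exact ⟨p, by rw [hp, regW_zero, one_mul]⟩

/-- The map `φ_J : (ι_J A)_0 → Hom_{gr A}(A, ι_J A)`, `φ_J(m)(a) = m · a`. -/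
def phi (J : ZFin) (m : ((invSet k J).obj (regA k)).deg 0) : BPart k J :=
  ⟨{ toFun := fun a : A k => ra m.1 a
     map_add' := fun a b => ra_add m.1 a b
     map_smul' := fun c a => ra_mul m.1 a c.unop },
    fun _ _ ha => ra_mem m.2 ha (zero_add _)⟩

theorem hPoly_zero : hPoly k (0 : ZFin).toFinset = 1 := Finset.prod_empty

theorem BPart.val_comm {I J : ZFin} (a : BPart k I) (b : BPart k J) :
    a.val * b.val = b.val * a.val := by
  obtain ⟨p, hp⟩ := a.exists_val
  obtain ⟨q, hq⟩ := b.exists_val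
  rw [hp, hq, pz_comm]

theorem mul_val_inj {I J : ZFin} {a b : A k}
    (h : pz (hPoly k (I.toFinset ∩ J.toFinset)) * a
      = pz (hPoly k (I.toFinset ∩ J.toFinset)) * b) : a = b := by
  rw [← sub_eq_zero]
  exact pz_mul_injective (hPoly_ne_zero _) (by rw [mul_sub, h, sub_self])

variable [CharZero k]

/-- The isomorphism `Θ_{J,I} : ι_J ι_I A → ι_{I ⊕ J} A` given by left multiplication by
`h_{I ∩ J}⁻¹`. -/
def theta (J I : ZFin) :
    (invSet k J).obj ((invSet k I).obj (regA k)) ≅ (invSet k (I + J)).obj (regA k) :=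
  (exists_theta I J).choose

theorem theta_spec (J I : ZFin) (v : (invSet k J).obj ((invSet k I).obj (regA k))) :
    pz (hPoly k (I.toFinset ∩ J.toFinset)) * inclA (I + J) ((theta J I).hom.1 v)
      = inclA I (((invSetIncl J).app ((invSet k I).obj (regA k))).1 v) :=
  (exists_theta I J).choose_spec v

/-- The multiplication `a · b = Θ_{J,I} ∘ ι_J(a) ∘ b` for `a ∈ B_I` and `b ∈ B_J`. -/
def BPart.mul {I J : ZFin} (a : BPart k I) (b : BPart k J) : BPart k (I + J) :=
  b.hom ≫ (invSet k J).map a.hom ≫ (theta J I).hom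

theorem BPart.val_mul {I J : ZFin} (a : BPart k I) (b : BPart k J) :
    pz (hPoly k (I.toFinset ∩ J.toFinset)) * (a.mul b).val = a.val * b.val := by
  have h1 := theta_spec J I (((invSet k J).map a.hom).1 (b.hom.1 (1 : A k)))
  have h2 := DFunLike.congr_fun (congrArg Subtype.val ((invSetIncl J).naturality a.hom))
    (b.hom.1 (1 : A k))
  refine h1.trans ?_
  refine (congrArg (inclA I) h2).trans ?_
  exact a.hom_apply (inclA J (b.hom.1 (1 : A k)))

/-- The element of `(ι_J A)_0` given by a multiple of `h_J`. -/
theorem exists_mem_invSet (J : ZFin) (p : k[X]) :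
    ∃ m : ((invSet k J).obj (regA k)).deg 0, inclA J m.1 = pz (hPoly k J.toFinset * p) := by
  obtain ⟨w, h, e⟩ := exists_isLadder (isLadder_reg (k := k)) (J.toFinset.sort (· ≤ ·))
  refine ⟨⟨ra (w 0) (pz p), ra_pz_mem (h.mem 0) p⟩, ?_⟩
  refine (map_ra ((invSetIncl J).app (regA k)) (w 0) (pz p)).trans ?_
  refine (congrArg (fun m : regA k => ra m (pz p)) (e 0)).trans ?_
  refine (ra_pz_pz (M := regA k) _ _ _).trans ?_
  change @Eq (A k) (regW 0 * pz _) _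
  rw [regW_zero, one_mul, (facs_zero (J.toFinset.sort_nodup (· ≤ ·))).2]
  congr 2
  rw [hPoly, Finset.prod_eq_multiset_prod, ← Multiset.prod_coe, ← Multiset.map_coe,
    Finset.sort_eq]

/-- The element of `B_J` that multiplies by `h_J p` from the left. -/
def elt (J : ZFin) (p : k[X]) : BPart k J := phi J (exists_mem_invSet J p).choose

theorem elt_val (J : ZFin) (p : k[X]) : (elt J p).val = pz (hPoly k J.toFinset * p) := by
  refine Eq.trans ?_ (exists_mem_invSet J p).choose_spec
  exact congrArg (inclA J) (ra_one _)

theorem elt_zero_val (p : k[X]) : (elt 0 p).val = pz p := by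
  rw [elt_val, hPoly_zero, one_mul]

theorem BPart.val_mul_of_disjoint {I J : ZFin} (a : BPart k I) (b : BPart k J)
    (h : I.toFinset ∩ J.toFinset = ∅) : (a.mul b).val = a.val * b.val := by
  rw [← a.val_mul b, h, hPoly, Finset.prod_empty, pz_one, one_mul]

/-- The multiplication is associative. -/
theorem BPart.mul_val_assoc {I J K : ZFin} (a : BPart k I) (b : BPart k J) (c : BPart k K) :
    ((a.mul b).mul c).val = (a.mul (b.mul c)).val := by
  obtain ⟨p, hp⟩ := a.exists_val
  have e1 := (a.mul b).val_mul c
  have e2 := a.val_mul b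
  have e3 := b.val_mul c
  have e4 := a.val_mul (b.mul c)
  have hh : hPoly k (I.toFinset ∩ J.toFinset) * hPoly k ((I + J).toFinset ∩ K.toFinset)
      = hPoly k (J.toFinset ∩ K.toFinset) * hPoly k (I.toFinset ∩ (J + K).toFinset) := by
    simp only [hPoly, ZFin.toFinset_add]
    rw [← Finset.prod_union, ← Finset.prod_union]
    · refine Finset.prod_congr ?_ fun _ _ => rfl
      ext x; simp only [Finset.mem_union, Finset.mem_inter, Finset.mem_symmDiff]; tauto
    · rw [Finset.disjoint_left]; intro x
      simp only [Finset.mem_inter, Finset.mem_symmDiff]; tauto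
    · rw [Finset.disjoint_left]; intro x
      simp only [Finset.mem_inter, Finset.mem_symmDiff]; tauto
  have f1 : pz (hPoly k (I.toFinset ∩ J.toFinset) * hPoly k ((I + J).toFinset ∩ K.toFinset)) *
      ((a.mul b).mul c).val = a.val * b.val * c.val := by
    rw [pz_mul, mul_assoc, e1, ← mul_assoc, e2]
  have f2 : pz (hPoly k (I.toFinset ∩ J.toFinset) * hPoly k ((I + J).toFinset ∩ K.toFinset)) *
      (a.mul (b.mul c)).val = a.val * b.val * c.val := by
    rw [hh, pz_mul, mul_assoc, e4, ← mul_assoc, hp, pz_comm, mul_assoc, e3, mul_assoc]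
  have hne : hPoly k (I.toFinset ∩ J.toFinset) * hPoly k ((I + J).toFinset ∩ K.toFinset) ≠ 0 :=
    mul_ne_zero (hPoly_ne_zero _) (hPoly_ne_zero _)
  rw [← sub_eq_zero]
  exact pz_mul_injective hne (by rw [mul_sub, f1, f2, sub_self])

instance : DirectSum.GNonUnitalNonAssocSemiring (BPart k) where
  mul := BPart.mul
  mul_zero {I J} a := BPart.val_injective (mul_val_inj (I := I) (J := J) (by
    rw [BPart.val_mul, BPart.val_zero, BPart.val_zero, mul_zero, mul_zero]))
  zero_mul {I J} b := BPart.val_injective (mul_val_inj (I := I) (J := J) (by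
    rw [BPart.val_mul, BPart.val_zero, BPart.val_zero, mul_zero, zero_mul]))
  mul_add {I J} a b c := BPart.val_injective (mul_val_inj (I := I) (J := J) (by
    simp only [BPart.val_mul, BPart.val_add, mul_add]))
  add_mul {I J} a b c := BPart.val_injective (mul_val_inj (I := I) (J := J) (by
    simp only [BPart.val_mul, BPart.val_add, mul_add, add_mul]))

instance : GradedMonoid.GOne (BPart k) where
  one := elt 0 1

instance : DirectSum.GRing (BPart k) where
  one_mul a := BPart.mk_eq (zero_add _) (by
    refine (BPart.val_mul_of_disjoint _ _ (Finset.empty_inter _)).trans ?_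
    exact (congrArg (fun t : A k => t * a.2.val) ((elt_zero_val 1).trans pz_one)).trans
      (one_mul _))
  mul_one a := BPart.mk_eq (add_zero _) (by
    refine (BPart.val_mul_of_disjoint _ _ (Finset.inter_empty _)).trans ?_
    exact (congrArg (fun t : A k => a.2.val * t) ((elt_zero_val 1).trans pz_one)).trans
      (mul_one _))
  mul_assoc a b c := BPart.mk_eq (add_assoc _ _ _) (BPart.mul_val_assoc a.2 b.2 c.2)
  natCast n := n • elt 0 1
  natCast_zero := zero_smul _ _
  natCast_succ n := succ_nsmul _ _
  intCast n := n • elt 0 1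
  intCast_ofNat n := natCast_zsmul _ _
  intCast_negSucc_ofNat n := negSucc_zsmul _ _

instance : DirectSum.GAlgebra k (BPart k) where
  toFun :=
    { toFun := fun c => c • elt 0 1
      map_zero' := zero_smul _ _
      map_add' := fun c d => add_smul _ _ _ }
  map_one := one_smul _ _
  map_mul r s := BPart.mk_eq (add_zero _).symm (by
    refine Eq.trans ?_ (BPart.val_mul_of_disjoint _ _ (Finset.inter_empty _)).symm
    change ((r * s) • elt 0 1).val = (r • elt 0 1).val * (s • elt 0 1).val
    simp only [BPart.val_smul, elt_zero_val, pz_one, smul_mul_smul_comm, one_mul])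
  commutes r x := BPart.mk_eq (add_comm _ _) (by
    refine (BPart.val_mul_of_disjoint _ _ (Finset.empty_inter _)).trans ?_
    refine Eq.trans ?_ (BPart.val_mul_of_disjoint _ _ (Finset.inter_empty _)).symm
    exact BPart.val_comm _ _)
  smul_def r x := BPart.mk_eq (zero_add _).symm (by
    refine Eq.trans ?_ (BPart.val_mul_of_disjoint _ _ (Finset.empty_inter _)).symm
    change (r • x.2).val = (r • elt 0 1).val * x.2.val
    simp only [BPart.val_smul, elt_zero_val, pz_one, smul_mul_assoc, one_mul])

variable (k)

/-- The `ℤ_fin`-graded ring `B = ⨁_J Hom_{gr A}(A, ι_J A)`. -/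
abbrev B : Type u := DirectSum ZFin (BPart k)

/-- The homogeneous component of degree `J` of `B`. -/
def gradeB (J : ZFin) : Submodule k (B k) := LinearMap.range (DirectSum.lof k ZFin (BPart k) J)

/-- The element `z` of `B_∅`: left multiplication by `z`. -/
def zB : B k := DirectSum.of (BPart k) 0 (elt 0 X)

/-- The element `b_n = φ_n(h_n)` of `B_{{n}}`. -/
def bB (n : ℤ) : B k := DirectSum.of (BPart k) (ZFin.single n) (elt (ZFin.single n) 1)

end RingB

section Presentation

variable (k : Type u) [Field k]

/-- The relations `b_n² = (z + n)²`. -/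
def relIdeal : Ideal (MvPolynomial ℤ k[X]) :=
  Ideal.span (Set.range fun n : ℤ =>
    (MvPolynomial.X n ^ 2 - MvPolynomial.C ((X + C (n : k)) ^ 2) : MvPolynomial ℤ k[X]))

/-- The ring `k[z][b_n | n ∈ ℤ] / (b_n² = (z + n)²)`. -/
abbrev Pres : Type u := MvPolynomial ℤ k[X] ⧸ relIdeal k

/-- The homogeneous component of degree `J ∈ ℤ_fin` for `deg z = ∅` and `deg b_n = {n}`. -/
def gradePres (J : ZFin) : Submodule k (Pres k) :=
  ((MvPolynomial.weightedHomogeneousSubmodule k[X] ZFin.single J).restrictScalars k).map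
    (Ideal.Quotient.mkₐ k (relIdeal k)).toLinearMap

end Presentation

end GenWeyl

end

noncomputable section

namespace GenWeyl

universe u

/-! ### Products over symmetric differences -/

/-! A morphism `A → ι_J A` is determined by the image of `1`, an element of degree `0` of `ι_J A ⊆
A`. In degree `0` the passage from `A` to `ι_J A` replaces the generator `1` by `h_J`, so `(ι_J A)_0
= h_J k[z]`. Hence every element of `B_J` is left multiplication by `h_J p` for a unique polynomial
`p`; this morphism is `elt J p` (`elt_injective`, `elt_surjective`).

In these coordinates the product of `B` is explicit. The composite of the two morphisms, before `Θ`
is applied, multiplies by `h_I p · h_J q`, and `h_I h_J = h_{I ∩ J}² h_{I ⊕ J}`. Since `Θ` removes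
one factor `h_{I ∩ J}`, one such factor survives: the product of `elt I p` and `elt J q` is `elt (I
+ J) (p q h_{I ∩ J})` (`elt_mul`). In particular `b_n² = (z + n)²` (`bB_sq`), and the product of the
`b_n` over `J` is the generator `elt J 1` of `B_J` (`prod_bB`).

Squarefree monomials in the presented ring multiply by the same rule (`prod_presX_mul`), so sending
`elt J p` to `p ∏_{n ∈ J} b_n` defines an algebra homomorphism `toPres`. Conversely the relations
hold in `B`, so evaluation at the `b_n` descends to `ofPres`. The two are mutually inverse
(`ofPres_toPres`, `toPres_evalB`). No basis of the presented ring has to be known beforehand: the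
independence of the squarefree monomials is a consequence. The gradings agree because evaluation
sends a weighted homogeneous polynomial of degree `J` into `B_J`, while `B_J` maps to multiples of
the squarefree monomial of degree `J` (`map_gradeB`). -/

theorem ZFin.prod_mul_prod {R : Type*} [CommMonoid R] (g : ℤ → R) (I J : ZFin) :
    (∏ n ∈ I.toFinset, g n) * ∏ n ∈ J.toFinset, g n
      = (∏ n ∈ I.toFinset ∩ J.toFinset, g n) ^ 2 * ∏ n ∈ (I + J).toFinset, g n := by
  have h1 : I.toFinset ∪ J.toFinset = I.toFinset ∩ J.toFinset ∪ (I + J).toFinset := by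
    rw [ZFin.toFinset_add]
    ext x; simp only [Finset.mem_union, Finset.mem_inter, Finset.mem_symmDiff]; tauto
  have h2 : Disjoint (I.toFinset ∩ J.toFinset) (I + J).toFinset := by
    rw [ZFin.toFinset_add, Finset.disjoint_left]; intro x
    simp only [Finset.mem_inter, Finset.mem_symmDiff]; tauto
  -- The two products make one over the union and one over the intersection. The union splits into
  -- the disjoint sets `I ∩ J` and `I ⊕ J`, so the intersection is counted twice.
  rw [← Finset.prod_union_inter, h1, Finset.prod_union h2, pow_two, mul_right_comm]

theorem ZFin.single_add_self (n : ℤ) : ZFin.single n + ZFin.single n = 0 :=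
  symmDiff_self ({n} : Finset ℤ)

theorem ZFin.single_add {n : ℤ} {S : Finset ℤ} (hn : n ∉ S) :
    ZFin.single n + toBoolRing S = toBoolRing (insert n S) := by
  change symmDiff {n} S = insert n S
  rw [(Finset.disjoint_singleton_left.2 hn).symmDiff_eq_sup]
  rfl

/-- This is the degree of the squarefree monomial on `S`, as needed in `map_gradeB`. -/
theorem ZFin.sum_single (S : Finset ℤ) : ∑ n ∈ S, ZFin.single n = toBoolRing S := by
  induction S using Finset.induction_on with
  | empty => rfl
  | insert n S hn ih => rw [Finset.sum_insert hn, ih, ZFin.single_add hn]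

/-! ### The homogeneous components of `B` in coordinates -/

section Components

variable {k : Type u} [Field k]

theorem of_mem_gradeB (J : ZFin) (a : BPart k J) : DirectSum.of (BPart k) J a ∈ gradeB k J :=
  ⟨a, rfl⟩

/-- The degree `0` part of `A` is free over `k[z]` on `regW 0 = 1`, so this is the case `i = 0` of
`regW_free`. -/
theorem pz_injective : Function.Injective (pz : k[X] → A k) := by
  intro p q h
  rw [← sub_eq_zero]
  refine regW_free 0 _ ?_
  rw [regW_zero, one_mul, pz, map_sub, sub_eq_zero]
  exact h

variable [CharZero k]

theorem elt_injective (J : ZFin) : Function.Injective (elt (k := k) J) := by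
  intro p q h
  have h1 := congrArg BPart.val h
  rw [elt_val, elt_val] at h1
  exact mul_left_cancel₀ (hPoly_ne_zero _) (pz_injective h1)

/-- The image of `1` has degree `0`, so the ladder of `ι_J A` writes it as `w 0` times a polynomial.
The inclusion into `A` carries `w 0` to `h_J`, because by `facs_zero` each `ι_j` with `j ∈ J`
contributes exactly `(z + j)²` in degree `0`. -/
theorem elt_surjective (J : ZFin) : Function.Surjective (elt (k := k) J) := by
  intro a
  obtain ⟨w, h, e⟩ := exists_isLadder (isLadder_reg (k := k)) (J.toFinset.sort (· ≤ ·))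
  obtain ⟨p, hp⟩ := h.span 0 (a.hom.1 (1 : A k)) (a.hom.2 0 _ (one_mem_grade _))
  refine ⟨p, BPart.val_injective ?_⟩
  rw [elt_val]
  symm
  refine (congrArg (inclA J) hp).trans ?_
  refine (map_ra ((invSetIncl J).app (regA k)) (w 0) (pz p)).trans ?_
  refine (congrArg (fun m : regA k => ra m (pz p)) (e 0)).trans ?_
  refine (ra_pz_pz (M := regA k) _ _ _).trans ?_
  change @Eq (A k) (regW 0 * pz _) _
  rw [regW_zero, one_mul, (facs_zero (J.toFinset.sort_nodup (· ≤ ·))).2]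
  congr 2
  -- The ladder yields the product over the sorted list of `J`, and `h_J` is the product over the
  -- finset; multisets mediate between the two.
  rw [hPoly, Finset.prod_eq_multiset_prod, ← Multiset.prod_coe, ← Multiset.map_coe,
    Finset.sort_eq]

/-- The factor `h_{I ∩ J}` remains because `h_I h_J` contains its square and `Θ` divides by it only
once. -/
theorem elt_mul (I J : ZFin) (p q : k[X]) :
    (elt I p).mul (elt J q) = elt (I + J) (p * q * hPoly k (I.toFinset ∩ J.toFinset)) := by
  -- Left multiplication by `h_{I ∩ J}` is injective on `A`, so the comparison can be made after
  -- clearing the denominator of `Θ`, where `BPart.val_mul` applies.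
  refine BPart.val_injective (mul_val_inj (I := I) (J := J) ?_)
  rw [BPart.val_mul, elt_val, elt_val, elt_val, ← pz_mul, ← pz_mul]
  congr 1
  simp only [hPoly]
  linear_combination p * q * ZFin.prod_mul_prod (fun n : ℤ => (X + C (n : k)) ^ 2) I J

/-- Each homogeneous component of `B` is a free `k[z]`-module of rank one, generated by
multiplication by `h_J`. -/
def eltEquiv (J : ZFin) : k[X] ≃ₗ[k] BPart k J :=
  LinearEquiv.ofBijective
    { toFun := elt J
      map_add' := fun p q => BPart.val_injective (by
        rw [BPart.val_add, elt_val, elt_val, elt_val, mul_add, pz_add])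
      map_smul' := fun c p => BPart.val_injective (by
        rw [RingHom.id_apply, BPart.val_smul, elt_val, elt_val, mul_smul_comm, pz, map_smul]; rfl) }
    ⟨elt_injective J, elt_surjective J⟩

theorem eltEquiv_symm_elt (J : ZFin) (p : k[X]) : (eltEquiv J).symm (elt J p) = p :=
  (eltEquiv J).symm_apply_apply p

/-! ### Commutativity of `B` and products of the generators `b_n`. -/

/-- Homogeneous elements act as left multiplications by polynomials in `z`, which commute, and the
denominator `h_{I ∩ J}` is symmetric in `I` and `J`. Commutativity of `B` is what gives meaning to
products over finsets and to evaluation of polynomials in the `b_n`. -/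
instance : DirectSum.GCommRing (BPart k) where
  mul_comm a b := BPart.mk_eq (add_comm _ _) (by
    refine mul_val_inj (I := a.1) (J := b.1) ?_
    refine (a.2.val_mul b.2).trans ((BPart.val_comm _ _).trans ?_)
    rw [Finset.inter_comm]
    exact (b.2.val_mul a.2).symm)

theorem of_elt_mul (I J : ZFin) (p q : k[X]) :
    DirectSum.of (BPart k) I (elt I p) * DirectSum.of (BPart k) J (elt J q)
      = DirectSum.of (BPart k) (I + J)
          (elt (I + J) (p * q * hPoly k (I.toFinset ∩ J.toFinset))) := by
  rw [DirectSum.of_mul_of, ← elt_mul]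
  rfl

/-- The zero of `ℤ_fin` is the empty set, so the factor in `elt_mul` is the empty product. Thus
`B_∅` acts on each coordinate as `k[z]` does. -/
theorem of_elt_zero_mul (J : ZFin) (p q : k[X]) :
    DirectSum.of (BPart k) 0 (elt 0 p) * DirectSum.of (BPart k) J (elt J q)
      = DirectSum.of (BPart k) J (elt J (p * q)) := by
  rw [of_elt_mul, zero_add]
  congr 2
  refine (congrArg (p * q * ·) (?_ : _ = (1 : k[X]))).trans (mul_one _)
  exact (congrArg (hPoly k) (Finset.empty_inter _)).trans Finset.prod_empty

/-- Here the two degrees coincide, so the surviving factor is the full `h_{{n}} = (z + n)²`. This is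
the relation that makes `ofPres` well defined. -/
theorem bB_sq (n : ℤ) :
    bB k n ^ 2 = DirectSum.of (BPart k) 0 (elt 0 ((X + C (n : k)) ^ 2)) := by
  rw [pow_two, bB, of_elt_mul, ZFin.single_add_self]
  congr 2
  rw [one_mul, one_mul, Finset.inter_self]
  exact Finset.prod_singleton _ _

/-- Distinct `b_n` have disjoint degrees, so no factor `h` appears when they are multiplied. -/
theorem prod_bB (S : Finset ℤ) :
    ∏ n ∈ S, bB k n = DirectSum.of (BPart k) (toBoolRing S) (elt (toBoolRing S) 1) := by
  induction S using Finset.induction_on with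
  -- The unit of `B` is `elt 0 1` by definition.
  | empty => rfl
  | insert n S hn ih =>
    rw [Finset.prod_insert hn, ih, bB, of_elt_mul]
    have h2 : (ZFin.single n).toFinset ∩ ZFin.toFinset (toBoolRing S) = ∅ :=
      Finset.singleton_inter_of_notMem hn
    rw [ZFin.single_add hn, h2, hPoly, Finset.prod_empty, mul_one, mul_one]

/-- This shows that `k[z]` and the `b_n` generate `B`, and it gives the polynomial expression used
in `ofPres_toPres`. -/
theorem of_elt (J : ZFin) (p : k[X]) : DirectSum.of (BPart k) J (elt J p)
    = DirectSum.of (BPart k) 0 (elt 0 p) * ∏ n ∈ J.toFinset, bB k n := by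
  rw [prod_bB]
  exact ((of_elt_zero_mul J p 1).trans (by rw [mul_one])).symm

end Components

/-! ### The isomorphism -/

section Isomorphism

variable (k : Type u) [Field k]

/-! ### Squarefree monomials in the presented ring. -/

/-- The structure map `k[z] → k[z][b_n | n ∈ ℤ] / (b_n² = (z + n)²)`. -/
def presC : k[X] →ₐ[k] Pres k :=
  (Ideal.Quotient.mkₐ k (relIdeal k)).comp (IsScalarTower.toAlgHom k k[X] (MvPolynomial ℤ k[X]))

/-- The generator `b_n` of `k[z][b_n | n ∈ ℤ] / (b_n² = (z + n)²)`. -/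
def presX (n : ℤ) : Pres k := Ideal.Quotient.mk (relIdeal k) (MvPolynomial.X n)

theorem presC_apply (p : k[X]) :
    presC k p = Ideal.Quotient.mk (relIdeal k) (MvPolynomial.C p) := rfl

theorem presX_sq (n : ℤ) : presX k n ^ 2 = presC k ((X + C (n : k)) ^ 2) :=
  Ideal.Quotient.eq.2 (Ideal.subset_span ⟨n, rfl⟩)

/-- Generators indexed by `I ∩ J` occur squared, and the relations turn those squares into `h_{I ∩
J}`. This mirrors `elt_mul` and makes `toPres` multiplicative. -/
theorem prod_presX_mul (I J : ZFin) :
    (∏ n ∈ I.toFinset, presX k n) * ∏ n ∈ J.toFinset, presX k n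
      = presC k (hPoly k (I.toFinset ∩ J.toFinset)) * ∏ n ∈ (I + J).toFinset, presX k n := by
  rw [ZFin.prod_mul_prod, hPoly, map_prod, ← Finset.prod_congr rfl fun n _ => presX_sq k n,
    Finset.prod_pow]

/-! ### The homomorphism from `B` to the presented ring. -/

variable [CharZero k]

/-- The homomorphism from `B` to the presented ring on the component of degree `J`. -/
def toPresPart (J : ZFin) : BPart k J →ₗ[k] Pres k :=
  (LinearMap.mulRight k (∏ n ∈ J.toFinset, presX k n)).comp
    ((presC k).toLinearMap.comp (eltEquiv J).symm.toLinearMap)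

theorem toPresPart_elt (J : ZFin) (p : k[X]) :
    toPresPart k J (elt J p) = presC k p * ∏ n ∈ J.toFinset, presX k n :=
  congrArg (fun q => presC k q * ∏ n ∈ J.toFinset, presX k n) (eltEquiv_symm_elt J p)

/-- The homomorphism from `B` to the presented ring. -/
def toPres : B k →ₐ[k] Pres k :=
  DirectSum.toAlgebra k (BPart k) (toPresPart k)
    (by
      refine (toPresPart_elt k 0 1).trans ?_
      rw [map_one, one_mul]
      exact Finset.prod_empty)
    (by
      intro I J a b
      -- In coordinates, both sides acquire the same factor `h_{I ∩ J}`: on `B` from `Θ`, on the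
      -- presented ring from the relations.
      obtain ⟨p, rfl⟩ := elt_surjective I a
      obtain ⟨q, rfl⟩ := elt_surjective J b
      refine (congrArg (toPresPart k (I + J)) (elt_mul I J p q)).trans ?_
      rw [toPresPart_elt, toPresPart_elt, toPresPart_elt, map_mul, map_mul]
      linear_combination -presC k p * presC k q * prod_presX_mul k I J)

theorem toPres_of_elt (J : ZFin) (p : k[X]) :
    toPres k (DirectSum.of (BPart k) J (elt J p))
      = presC k p * ∏ n ∈ J.toFinset, presX k n :=
  (DirectSum.toModule_lof k J (elt J p)).trans (toPresPart_elt k J p)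

theorem toPres_of_elt_zero (p : k[X]) :
    toPres k (DirectSum.of (BPart k) 0 (elt 0 p)) = presC k p := by
  rw [toPres_of_elt]
  exact (congrArg (presC k p * ·) Finset.prod_empty).trans (mul_one _)

theorem toPres_bB (n : ℤ) : toPres k (bB k n) = presX k n := by
  rw [bB, toPres_of_elt, map_one, one_mul]
  exact Finset.prod_singleton _ _

/-! ### Evaluation of polynomials in `B` and the inverse homomorphism. -/

/-- The structure map `k[z] → B`. -/
def scalarB : k[X] →+* B k where
  toFun p := DirectSum.of (BPart k) 0 (elt 0 p)
  map_one' := rfl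
  map_mul' p q := (of_elt_zero_mul 0 p q).symm
  map_zero' := (congrArg _ ((eltEquiv 0).map_zero)).trans (map_zero _)
  map_add' p q := (congrArg _ ((eltEquiv 0).map_add p q)).trans (map_add _ _ _)

/-- The evaluation of polynomials in the `b_n` over `k[z]` in the ring `B`. -/
def evalB : MvPolynomial ℤ k[X] →+* B k := MvPolynomial.eval₂Hom (scalarB k) (bB k)

theorem evalB_C (p : k[X]) :
    evalB k (MvPolynomial.C p) = DirectSum.of (BPart k) 0 (elt 0 p) :=
  MvPolynomial.eval₂Hom_C _ _ _

theorem evalB_X (n : ℤ) : evalB k (MvPolynomial.X n) = bB k n :=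
  MvPolynomial.eval₂Hom_X' _ _ _

/-- The homomorphism from the presented ring to `B`. -/
def ofPres : Pres k →+* B k :=
  Ideal.Quotient.lift (relIdeal k) (evalB k) fun a ha => by
    -- Only the generators of the ideal need to be killed, and for these the claim is `bB_sq`.
    have : relIdeal k ≤ RingHom.ker (evalB k) := by
      refine Ideal.span_le.2 ?_
      rintro _ ⟨n, rfl⟩
      change evalB k _ = 0
      rw [map_sub, map_pow, evalB_X, evalB_C, bB_sq, sub_self]
    exact this ha

theorem ofPres_mk (q : MvPolynomial ℤ k[X]) :
    ofPres k (Ideal.Quotient.mk (relIdeal k) q) = evalB k q := Ideal.Quotient.lift_mk _ _ _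

/-- By additivity homogeneous elements suffice, and `of_elt` expresses these through `k[z]` and the
`b_n`. The left inverse yields injectivity of `toPres` without any independence statement in the
presented ring. -/
theorem ofPres_toPres (b : B k) : ofPres k (toPres k b) = b := by
  induction b using DirectSum.induction_on with
  | zero => rw [map_zero, map_zero]
  | add a b h1 h2 => rw [map_add, map_add, h1, h2]
  | of J a =>
    obtain ⟨p, rfl⟩ := elt_surjective J a
    rw [toPres_of_elt, map_mul, map_prod, presC_apply, ofPres_mk, evalB_C, of_elt J p]
    congr 1
    exact Finset.prod_congr rfl fun n _ => (ofPres_mk k _).trans (evalB_X k n)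

/-- Stating this for polynomials instead of classes lets it serve twice: for surjectivity of
`toPres`, and in `map_gradeB`, where a weighted homogeneous representative must be kept. -/
theorem toPres_evalB (q : MvPolynomial ℤ k[X]) :
    toPres k (evalB k q) = Ideal.Quotient.mk (relIdeal k) q := by
  induction q using MvPolynomial.induction_on with
  | C p => rw [evalB_C, toPres_of_elt_zero, presC_apply]
  | add p q h1 h2 => rw [map_add, map_add, h1, h2, map_add]
  | mul_X p n h => rw [map_mul, map_mul, h, evalB_X, toPres_bB, map_mul]; rfl

/-- The isomorphism from `B` to the presented ring. -/
def equivPres : B k ≃ₐ[k] Pres k :=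
  AlgEquiv.ofBijective (toPres k) ⟨Function.LeftInverse.injective (ofPres_toPres k), fun x => by
    obtain ⟨q, rfl⟩ := Ideal.Quotient.mk_surjective x
    exact ⟨_, toPres_evalB k q⟩⟩

/-! ### Compatibility with the gradings -/

theorem mul_mem_gradeB {I J : ZFin} {a b : B k} (ha : a ∈ gradeB k I) (hb : b ∈ gradeB k J) :
    a * b ∈ gradeB k (I + J) := by
  obtain ⟨a, rfl⟩ := ha
  obtain ⟨b, rfl⟩ := hb
  rw [DirectSum.lof_eq_of, DirectSum.lof_eq_of, DirectSum.of_mul_of]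
  exact of_mem_gradeB _ _

theorem pow_mem_gradeB {J : ZFin} {a : B k} (ha : a ∈ gradeB k J) (m : ℕ) :
    a ^ m ∈ gradeB k (m • J) := by
  induction m with
  | zero => rw [pow_zero, zero_smul]; exact of_mem_gradeB 0 _
  | succ m ih => rw [pow_succ, succ_nsmul]; exact mul_mem_gradeB k ih ha

/-- The weight is computed in `ℤ_fin`, where exponents count only modulo `2`; arbitrary monomials
are therefore covered without reducing them to squarefree ones. -/
theorem evalB_monomial_mem (s : ℤ →₀ ℕ) (p : k[X]) :
    evalB k (MvPolynomial.monomial s p) ∈ gradeB k (Finsupp.weight ZFin.single s) := by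
  induction s using Finsupp.induction generalizing p with
  | zero =>
    rw [map_zero, ← MvPolynomial.C_apply, evalB_C]
    exact of_mem_gradeB _ _
  | single_add n m s _ _ ih =>
    -- The power of `b_n` is split off with coefficient `1`, leaving `p` with the remaining monomial
    -- for the induction hypothesis.
    rw [map_add, Finsupp.weight_single, ← one_mul p, ← MvPolynomial.monomial_mul, map_mul]
    refine mul_mem_gradeB k ?_ (ih p)
    rw [← MvPolynomial.X_pow_eq_monomial, map_pow, evalB_X]
    exact pow_mem_gradeB k (of_mem_gradeB _ _) m

theorem evalB_mem {q : MvPolynomial ℤ k[X]} {J : ZFin}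
    (hq : MvPolynomial.IsWeightedHomogeneous ZFin.single q J) : evalB k q ∈ gradeB k J := by
  rw [q.as_sum, map_sum]
  refine sum_mem fun s hs => ?_
  rw [← hq (MvPolynomial.mem_support_iff.1 hs)]
  exact evalB_monomial_mem k s _

theorem map_gradeB (J : ZFin) : (gradeB k J).map (equivPres k).toLinearMap = gradePres k J := by
  refine le_antisymm ?_ ?_
  · rintro _ ⟨_, ⟨a, rfl⟩, rfl⟩
    obtain ⟨p, rfl⟩ := elt_surjective J a
    -- This representative is read off from `toPres_of_elt`; its weight is `J` by `ZFin.sum_single`.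
    refine ⟨MvPolynomial.C p * ∏ n ∈ J.toFinset, MvPolynomial.X n, ?_, ?_⟩
    · have h := (MvPolynomial.IsWeightedHomogeneous.prod J.toFinset
        (fun n => (MvPolynomial.X n : MvPolynomial ℤ k[X])) ZFin.single
        fun n _ => MvPolynomial.isWeightedHomogeneous_X k[X] ZFin.single n).C_mul p
      rw [ZFin.sum_single] at h
      exact h
    · refine Eq.trans ?_ (toPres_of_elt k J p).symm
      change Ideal.Quotient.mk (relIdeal k) _ = _
      rw [map_mul, map_prod]
      rfl
  · rintro _ ⟨q, hq, rfl⟩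
    -- Evaluation preserves degrees, so it supplies a preimage already lying in `B_J`.
    exact ⟨evalB k q, evalB_mem k hq, toPres_evalB k q⟩

end Isomorphism

end GenWeyl

end

/-- The `ℤ_fin`-graded ring `B = ⨁_J Hom_{gr A}(A, ι_J A)`, for `A = A(z²)`, is isomorphic as a
`ℤ_fin`-graded `k`-algebra to `k[z][b_n | n ∈ ℤ] / (b_n² = (z + n)²)` with `deg z = ∅` and
`deg b_n = {n}`; the isomorphism matches the elements `z` and `b_n` of `B` with the generators. -/
theorem mainTheorem7 (k : Type*) [Field k] [IsAlgClosed k] [CharZero k] :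
    ∃ e : GenWeyl.B k ≃ₐ[k] GenWeyl.Pres k,
      e (GenWeyl.zB k) = Ideal.Quotient.mk (GenWeyl.relIdeal k) (MvPolynomial.C Polynomial.X) ∧
      (∀ n : ℤ, e (GenWeyl.bB k n) =
        Ideal.Quotient.mk (GenWeyl.relIdeal k) (MvPolynomial.X n)) ∧
      ∀ J : GenWeyl.ZFin,
        (GenWeyl.gradeB k J).map e.toLinearMap = GenWeyl.gradePres k J := by
  -- Since `zB` is `elt 0 X` placed in degree `0`, its image is the case `p = X` of
  -- `toPres_of_elt_zero`.
  exact ⟨GenWeyl.equivPres k, GenWeyl.toPres_of_elt_zero k Polynomial.X, GenWeyl.toPres_bB k,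
    GenWeyl.map_gradeB k⟩
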